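/- **Setting.** For each $n\ge 1$ let $H=H(n)$ be an $n\times n$ Hermitian matrix, $\beta=\beta(n)>0$ and $\sigma=\sigma(n)>0$ with $\sigma=\Theta(\beta^{-1})$ as $n\to\infty$. Put $$f(t)=e^{-\sigma^2t^2}\sqrt{\sigma\sqrt{2/\pi}},\quad \hat f(\omega)=\frac{e^{-\omega^2/(4\sigma^2)}}{\sqrt{\sigma\sqrt{2\pi}}},\quad \gamma(\omega)=e^{-\beta\max(\omega+\beta\sigma^2/2,\,0)},$$ $$\theta(\nu_1,\nu_2)=\int_{\mathbb R}\hat f(\omega-\nu_1)\hat f(\omega-\nu_2)\gamma(\omega)\,d\omega,\qquad \alpha(\nu)=\theta(\nu,\nu).$$ For a matrix $A$ let $\hat A(\omega)=\frac1{\sqrt{2\pi}}\int_{\mathbb R} e^{iHt}Ae^{-iHt}e^{-i\omega t}f(t)\,dt$, and let $A_\nu=\sum_{E_l-E_m=\nu}|l\rangle\langle l|A|m\rangle\langle m|$, where $|j\rangle$ is an orthonormal eigenbasis of $H$ with energies $E_j$. The CKG Lindbladian with jump operators $(A^a)_a$ is $$\mathcal L_\beta[N]=-i[B,N]+\sum_a\int_{\mathbb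 R}\gamma(\omega)\Big(\hat A^a(\omega)N\hat A^a(\omega)^\dagger-\tfrac12\{\hat A^a(\omega)^\dagger\hat A^a(\omega),N\}\Big)d\omega,$$ $$B=\sum_a\sum_{\nu_1,\nu_2}\frac{\tanh(-\beta(\nu_1-\nu_2)/4)}{2i}\,\theta(\nu_1,\nu_2)\,(A^a_{\nu_2})^\dagger A^a_{\nu_1}.$$ Let $\mathcal D=\mathcal D(n)$ be a unitary $1$-design, that is, a Borel probability measure on $U(n)$ with $\mathbb E_{V\sim\mathcal D}[VXV^\dagger]=\mathbb E_{V\sim\mathrm{Haar}}[VXV^\dagger]$ for all matrices $X$ (for instance the Haar measure itself). Let $\mathcal L_\mu=\mathbb E_{V\sim\mathcal D}[\mathcal L_\beta]$, where $\mathcal L_\beta$ has the single jump operator $V$. The spectral gap $\lambda_{\rm gap}$ of a generator is the least modulus of its eigenvalues, counted with algebraic multiplicity, after one eigenvalue $0$ has been removed. **Lemma.** 1. The expectation $\mathcal L_\mu$ exists. For every orthonormal eigenbasis $(|j\rangle)$ of $H$ with energies $(E_j)$, $\mathcal L_\mu=\mathcal L_{\rm classical}+\mathcal L_{\rm dephasing}$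 with $$\mathcal L_{\rm classical}[N]=\sum_{l,m}Q_{lm}\langle m|N|m\rangle\,|l\rangle\langle l|,\qquad \mathcal L_{\rm dephasing}[N]=-\sum_{l\ne m}\kappa_{lm}\langle l|N|m\rangle\,|l\rangle\langle m|,$$ $$Q_{lm}=\tfrac1n\alpha(E_l-E_m)\ (l\neq m),\quad Q_{mm}=-\sum_{j\ne m}Q_{jm},\quad \kappa_{lm}=\tfrac1{2n}\sum_j\big(\alpha(E_j-E_l)+\alpha(E_j-E_m)\big).$$ Here $Q$ is the generator of a continuous-time Markov chain with strictly positive jump rates ($Q_{lm}$ is the rate of $m\to l$), reversible with respect to the Gibbs distribution $e^{-\beta E_m}/\sum_je^{-\beta E_j}$; the rates $\kappa_{lm}$ ($l\ne m$) are strictly positive; and for $n\ge2$, $\lambda_{\rm gap}(\mathcal L_\mu)=\min\big(\lambda_{\rm gap}(Q),\min_{l\ne m}\kappa_{lm}\big)$. 2. Fix a constant $C$ and let $\delta(n)$ be the proportion of eigenvalues $\lambda_j$ of $H(n)$ (with multiplicity) such that $\beta(n)(\lambda_j-\lambda_{\min})\le C$. Then $\lambda_{\rm gap}(\mathcal L_\mu)=\Omega(\delta(n))$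 as $n\to\infty$. 3. If $\beta(n)\|H(n)\|=O(1)$ (operator norm), then $\lambda_{\rm gap}(\mathcal L_\mu)=\Omega(1)$. -/

import Mathlib

open Filter Asymptotics MeasureTheory
open scoped Matrix Matrix.Norms.L2Operator

/-! Matrices carry the operator norm of `ℂⁿ` with its Euclidean norm (scope
`Matrix.Norms.L2Operator`), so superoperators are continuous linear maps
`Matrix →L[ℂ] Matrix` and expectations of superoperators are Bochner integrals. -/

noncomputable section

namespace CKG

/-- Complex `n × n` matrices. -/
abbrev Mat (n : ℕ) : Type := Matrix (Fin n) (Fin n) ℂ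

/-- The unitary group `U(n)`. -/
abbrev U (n : ℕ) : Type := Matrix.unitaryGroup (Fin n) ℂ

/-- Linear maps on `n × n` matrices. -/
abbrev Superop (n : ℕ) : Type := Mat n →L[ℂ] Mat n

variable {n : ℕ}

/-! ### Haar measure and unitary 1-designs -/

/-- `U(n)` carries its Borel `σ`-algebra. -/
instance instMeasurableSpaceU (n : ℕ) : MeasurableSpace (U n) := borel _

instance instBorelSpaceU (n : ℕ) : BorelSpace (U n) := ⟨rfl⟩

instance instCompactSpaceU (n : ℕ) : CompactSpace (U n) := by
  suffices hc : IsCompact {A : Mat n | A ∈ Matrix.unitaryGroup (Fin n) ℂ} from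
    isCompact_iff_compactSpace.mp hc
  have : ProperSpace (Mat n) := FiniteDimensional.proper ℂ _
  apply Metric.isCompact_of_isClosed_isBounded
  · have h : {A : Mat n | A ∈ Matrix.unitaryGroup (Fin n) ℂ}
        = {A : Mat n | A * star A = 1} := by
      ext A
      exact Matrix.mem_unitaryGroup_iff
    rw [h]
    exact isClosed_eq (by fun_prop) continuous_const
  · refine isBounded_iff_forall_norm_le.mpr ⟨1, fun A hA => ?_⟩
    by_cases hn : Nonempty (Fin n)
    · exact (CStarRing.norm_of_mem_unitary (U := A) hA).le
    · have : IsEmpty (Fin n) := not_nonempty_iff.mp hn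
      have : A = 0 := Subsingleton.elim _ _
      simp [this]

/-- The Haar probability measure on `U(n)`. -/
def haarU (n : ℕ) : Measure (U n) := Measure.haarMeasure ⊤

instance instIsProbabilityMeasureHaarU (n : ℕ) : IsProbabilityMeasure (haarU n) :=
  ⟨by simpa [haarU] using Measure.haarMeasure_self (K₀ := (⊤ : TopologicalSpace.PositiveCompacts (U n)))⟩

/-- A probability distribution on `U(n)` is a unitary 1-design if it reproduces the Haar average
of every `X ↦ V X V†`. -/
def IsUnitaryOneDesign (D : Measure (U n)) : Prop :=
  ∀ X : Mat n, ∫ V : U n, (V : Mat n) * X * (V : Mat n)ᴴ ∂D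
    = ∫ V : U n, (V : Mat n) * X * (V : Mat n)ᴴ ∂(haarU n)

theorem isUnitaryOneDesign_haarU (n : ℕ) : IsUnitaryOneDesign (haarU n) := fun _ => rfl

/-! ### Filters -/

/-- The Gaussian window `f(t) = e^{-σ² t²} √(σ √(2/π))`. -/
def window (σ t : ℝ) : ℝ :=
  Real.exp (-(σ ^ 2 * t ^ 2)) * Real.sqrt (σ * Real.sqrt (2 / Real.pi))

/-- Its Fourier transform `f̂(ω) = exp(-ω² / (4σ²)) / √(σ √(2π))`. -/
def windowHat (σ ω : ℝ) : ℝ :=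
  1 / Real.sqrt (σ * Real.sqrt (2 * Real.pi)) * Real.exp (-(ω ^ 2 / (4 * σ ^ 2)))

/-- The shifted Metropolis filter `γ(ω) = exp(-β max(ω + βσ²/2, 0))`. -/
def gam (β σ ω : ℝ) : ℝ := Real.exp (-(β * max (ω + β * σ ^ 2 / 2) 0))

/-- `θ(ν₁, ν₂) = ∫ f̂(ω - ν₁) f̂(ω - ν₂) γ(ω) dω`. -/
def theta (β σ ν₁ ν₂ : ℝ) : ℝ :=
  ∫ ω : ℝ, windowHat σ (ω - ν₁) * windowHat σ (ω - ν₂) * gam β σ ω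

/-- `α(ν) = θ(ν, ν)`. -/
def alpha (β σ ν : ℝ) : ℝ := theta β σ ν ν

/-! ### The CKG Lindbladian -/

/-- The superoperator `N ↦ X N Y`. -/
def sandwich (X Y : Mat n) : Superop n := ContinuousLinearMap.mulLeftRight ℂ (Mat n) X Y

theorem sandwich_apply (X Y N : Mat n) : sandwich X Y N = X * N * Y := by
  simp [sandwich]

/-- The superoperator `N ↦ {X, N} = X N + N X`. -/
def anticomm (X : Mat n) : Superop n := sandwich X 1 + sandwich 1 X

/-- The superoperator `N ↦ [X, N] = X N - N X`. -/
def comm (X : Mat n) : Superop n := sandwich X 1 - sandwich 1 X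

/-- The operator Fourier transform
`Â(ω) = (2π)^{-1/2} ∫ e^{iHt} A e^{-iHt} e^{-iωt} f(t) dt`. -/
def oft (H : Mat n) (σ : ℝ) (A : Mat n) (ω : ℝ) : Mat n :=
  ((1 / Real.sqrt (2 * Real.pi) : ℝ) : ℂ) •
    ∫ t : ℝ, (Complex.exp (-(Complex.I * ω * t)) * (window σ t : ℂ)) •
      (NormedSpace.exp ((Complex.I * t) • H) * A * NormedSpace.exp (-((Complex.I * t) • H)))

/-- `|x⟩⟨y|` for two vectors. -/
def ketbra (x y : EuclideanSpace ℂ (Fin n)) : Mat n :=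
  Matrix.vecMulVec x.ofLp (star y.ofLp)

/-- The set of Bohr frequencies `E_l - E_m` of `H`. -/
def bohrFrequencies {H : Mat n} (hH : H.IsHermitian) : Finset ℝ :=
  Finset.image (fun p : Fin n × Fin n => hH.eigenvalues p.1 - hH.eigenvalues p.2) Finset.univ

/-- `A_ν = ∑_{E_l - E_m = ν} |l⟩⟨l| A |m⟩⟨m|`, the part of `A` with Bohr frequency `ν`. -/
def bohrComponent {H : Mat n} (hH : H.IsHermitian) (A : Mat n) (ν : ℝ) : Mat n :=
  ∑ l : Fin n, ∑ m : Fin n,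
    if hH.eigenvalues l - hH.eigenvalues m = ν then
      ketbra (hH.eigenvectorBasis l) (hH.eigenvectorBasis l) * A *
        ketbra (hH.eigenvectorBasis m) (hH.eigenvectorBasis m)
    else 0

/-- The Hamiltonian of the coherent term,
`B = ∑_a ∑_{ν₁,ν₂} tanh(-β(ν₁-ν₂)/4) / (2i) · θ(ν₁,ν₂) (A^a_{ν₂})† A^a_{ν₁}`. -/
def coherentB {ι : Type*} [Fintype ι] {H : Mat n} (hH : H.IsHermitian) (β σ : ℝ)
    (A : ι → Mat n) : Mat n :=
  ∑ a : ι, ∑ ν₁ ∈ bohrFrequencies hH, ∑ ν₂ ∈ bohrFrequencies hH,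
    (((Real.tanh (-(β * (ν₁ - ν₂)) / 4) * theta β σ ν₁ ν₂ : ℝ) : ℂ) / (2 * Complex.I)) •
      ((bohrComponent hH (A a) ν₂)ᴴ * bohrComponent hH (A a) ν₁)

/-- The CKG Lindbladian with Hamiltonian `H`, inverse temperature `β`, energy resolution `σ` and
jump operators `A`:
`L[N] = -i[B, N] + ∑_a ∫ γ(ω) (Â^a(ω) N Â^a(ω)† - ½ {Â^a(ω)† Â^a(ω), N}) dω`. -/
def lindbladian {ι : Type*} [Fintype ι] {H : Mat n} (hH : H.IsHermitian) (β σ : ℝ)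
    (A : ι → Mat n) : Superop n :=
  (-Complex.I) • comm (coherentB hH β σ A) +
    ∑ a : ι, ∫ ω : ℝ, (gam β σ ω : ℂ) •
      (sandwich (oft H σ (A a) ω) (oft H σ (A a) ω)ᴴ
        - (1 / 2 : ℂ) • anticomm ((oft H σ (A a) ω)ᴴ * oft H σ (A a) ω))

/-- The CKG Lindbladian with the single unitary jump operator `V`. -/
def jumpLindbladian {H : Mat n} (hH : H.IsHermitian) (β σ : ℝ) (V : U n) : Superop n :=
  lindbladian hH β σ (fun _ : Unit => (V : Mat n))

/-- The expected CKG Lindbladian over one jump operator drawn from `D`. -/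
def averageLindbladian {H : Mat n} (hH : H.IsHermitian) (β σ : ℝ) (D : Measure (U n)) :
    Superop n :=
  ∫ V : U n, jumpLindbladian hH β σ V ∂D

/-! ### Spectral quantities -/

/-- The spectral gap of a generator: the least modulus of its eigenvalues, listed with algebraic
multiplicity, after one copy of the eigenvalue `0` has been removed. It is `0` when the eigenvalue
`0` is degenerate. -/
def spectralGap {V : Type*} [AddCommGroup V] [Module ℂ V] [FiniteDimensional ℂ V]
    (T : V →ₗ[ℂ] V) : ℝ :=
  sInf {r : ℝ | ∃ z ∈ T.charpoly.roots.erase 0, r = ‖z‖}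

/-- The proportion of eigenvalues `λ_j` of `H`, with multiplicity, such that
`β (λ_j - λ_min) ≤ C`. -/
def lowEnergyFraction {H : Mat n} (hH : H.IsHermitian) (β C : ℝ) : ℝ :=
  (Nat.card {j : Fin n // β * (hH.eigenvalues j - ⨅ k, hH.eigenvalues k) ≤ C} : ℝ) / n

/-! ### The classical and dephasing parts

Here `v` is an orthonormal basis of energy eigenvectors and `E` lists their energies. -/

/-- The transition-rate matrix of the classical chain: the rate of the jump `m → l`, `l ≠ m`, is
`α(E_l - E_m) / n`, and each column sums to zero. It acts on column vectors of populations. -/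
def classicalGenerator (β σ : ℝ) (E : Fin n → ℝ) : Matrix (Fin n) (Fin n) ℝ :=
  Matrix.of fun l m =>
    if l = m then -∑ j ∈ Finset.univ.erase m, alpha β σ (E j - E m) / n
    else alpha β σ (E l - E m) / n

/-- The decay rate `(1/2n) ∑_j (α(E_j - E_l) + α(E_j - E_m))` of the coherence `|l⟩⟨m|`. -/
def dephasingRate (β σ : ℝ) (E : Fin n → ℝ) (l m : Fin n) : ℝ :=
  1 / (2 * n) * ∑ j, (alpha β σ (E j - E l) + alpha β σ (E j - E m))

/-- The Gibbs probability `e^{-β E_m} / ∑_j e^{-β E_j}`. -/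
def gibbs (β : ℝ) (E : Fin n → ℝ) (m : Fin n) : ℝ :=
  Real.exp (-(β * E m)) / ∑ j, Real.exp (-(β * E j))

/-- `N ↦ ∑_{l,m} Q_{lm} ⟨m|N|m⟩ |l⟩⟨l|` for the classical rate matrix `Q`. -/
def classicalPart (β σ : ℝ) (E : Fin n → ℝ)
    (v : OrthonormalBasis (Fin n) ℂ (EuclideanSpace ℂ (Fin n))) : Superop n :=
  ∑ l, ∑ m, (classicalGenerator β σ E l m : ℂ) • sandwich (ketbra (v l) (v m)) (ketbra (v m) (v l))

/-- `N ↦ -∑_{l ≠ m} κ_{lm} ⟨l|N|m⟩ |l⟩⟨m|` for the dephasing rates `κ`. -/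
def dephasingPart (β σ : ℝ) (E : Fin n → ℝ)
    (v : OrthonormalBasis (Fin n) ℂ (EuclideanSpace ℂ (Fin n))) : Superop n :=
  -∑ l, ∑ m ∈ Finset.univ.erase l,
    (dephasingRate β σ E l m : ℂ) • sandwich (ketbra (v l) (v l)) (ketbra (v m) (v m))

end CKG

end

/-! The Lindbladian is a quadratic form in the matrix elements `⟨l|V|m⟩` of the jump operator, with
`θ(E_l - E_m, E_l' - E_m')` weighting the pair `⟨l|V|m⟩`, `⟨l'|V|m'⟩`. A 1-design makes distinct
matrix elements uncorrelated with variance `1/n`, so only the weights `α(E_l - E_m)/n` survive; the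
coherent term vanishes because `tanh 0 = 0`. What remains preserves the span of the populations,
where it acts as the rate matrix `Q`, and scales each coherence `|l⟩⟨m|` by `-κ_lm`.

If all jumps into `l` have rate at least `u_l`, then subtracting the rank-one matrix `u 1ᵀ` from
`Q` leaves a matrix with nonnegative off-diagonal entries and column sums `-∑ u_l`, and replaces
one eigenvalue `0` of `Q` by `-∑ u_l` while keeping all the others. By Gershgorin's theorem these
have real part at most `-∑ u_l`. The same sum bounds every `κ_lm`. Finally `α ≥ γ/2`, since half
of the mass of `f̂(· - ν)²` lies below `ν`, and `γ(E_l - E_m)` is bounded below for low-energy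
`l`. -/

namespace CKG

variable {n : ℕ}

/-! ### Spectra of Markov generators -/

section MarkovGenerator

open Polynomial Matrix

variable {ι : Type*} [Fintype ι] [DecidableEq ι]

theorem charmatrix_mul_charmatrix_of_mul_eq_zero {R : Type*} [CommRing R] {A B : Matrix ι ι R}
    (h : B * A = 0) :
    B.charmatrix * A.charmatrix = (X : R[X]) • (A + B).charmatrix := by
  have hC : (C : R →+* R[X]).mapMatrix B * (C : R →+* R[X]).mapMatrix A = 0 := by
    rw [← map_mul, h, map_zero]
  simp only [charmatrix, scalar_apply, ← smul_one_eq_diagonal, sub_mul, mul_sub, smul_mul_assoc,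
    mul_smul_comm, one_mul, mul_one, map_add, hC, smul_sub, smul_add]
  abel

/-- With `B = -u wᵀ`, the previous identity multiplies two characteristic polynomials. -/
theorem X_mul_charpoly_sub_vecMulVec {R : Type*} [CommRing R] {A : Matrix ι ι R} {u w : ι → R}
    (hw : w ᵥ* A = 0) :
    X * (A - vecMulVec u w).charpoly = (X + C (u ⬝ᵥ w)) * A.charpoly := by
  cases isEmpty_or_nonempty ι
  · simp [charpoly, dotProduct]
  obtain ⟨k, hk⟩ := Nat.exists_eq_succ_of_ne_zero (Fintype.card_ne_zero (α := ι))
  have hmul : vecMulVec (-u) w * A = 0 := by rw [vecMulVec_mul, hw, vecMulVec_zero]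
  have hdet := congrArg det (charmatrix_mul_charmatrix_of_mul_eq_zero hmul)
  have hrank : (vecMulVec (-u) w).charpoly = X ^ k * (X + C (u ⬝ᵥ w)) := by
    rw [charpoly_vecMulVec, hk, Nat.succ_sub_one, neg_dotProduct, neg_smul, sub_neg_eq_add,
      smul_eq_C_mul, pow_succ]
    ring
  have hpoly : X ^ k * (X * (A - vecMulVec u w).charpoly)
      = X ^ k * ((X + C (u ⬝ᵥ w)) * A.charpoly) := by
    rw [det_mul, det_smul, neg_vecMulVec, ← sub_eq_add_neg, ← neg_vecMulVec, hk] at hdet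
    rw [← mul_assoc, ← pow_succ, ← mul_assoc, ← hrank]
    exact hdet.symm
  exact (monic_X_pow k).isRegular.left hpoly

section Field

variable {K : Type*} [Field K] {A : Matrix ι ι K} {u w : ι → K}

theorem zero_mem_roots_charpoly_of_vecMul_eq_zero (hw₀ : w ≠ 0) (hw : w ᵥ* A = 0) :
    0 ∈ A.charpoly.roots := by
  rw [mem_roots A.charpoly_monic.ne_zero, IsRoot, eval_charpoly]
  exact exists_vecMul_eq_zero_iff.mp ⟨w, hw₀, by simp [vecMul_neg, hw]⟩

theorem roots_charpoly_sub_vecMulVec [DecidableEq K] (hw₀ : w ≠ 0) (hw : w ᵥ* A = 0) :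
    (A - vecMulVec u w).charpoly.roots = -(u ⬝ᵥ w) ::ₘ A.charpoly.roots.erase 0 := by
  have hroots := congrArg roots (X_mul_charpoly_sub_vecMulVec (u := u) hw)
  rw [roots_mul (mul_ne_zero X_ne_zero (charpoly_monic _).ne_zero),
    roots_mul (mul_ne_zero (X_add_C_ne_zero _) (charpoly_monic _).ne_zero), roots_X,
    roots_X_add_C, Multiset.singleton_add, Multiset.singleton_add,
    ← Multiset.cons_erase (zero_mem_roots_charpoly_of_vecMul_eq_zero hw₀ hw),
    Multiset.cons_swap, Multiset.cons_inj_right] at hroots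
  exact hroots

end Field

theorem re_le_of_mem_roots_charpoly {M : Matrix ι ι ℝ} {c : ℝ} (hM : ∀ l m, l ≠ m → 0 ≤ M l m)
    (hc : ∀ m, ∑ l, M l m ≤ c) {z : ℂ}
    (hz : z ∈ (M.map ((↑) : ℝ → ℂ)).charpoly.roots) : z.re ≤ c := by
  rw [← charpoly_transpose, ← charpoly_toLin', mem_roots (LinearMap.charpoly_monic _).ne_zero,
    ← Module.End.hasEigenvalue_iff_isRoot_charpoly] at hz
  obtain ⟨m, hm⟩ := eigenvalue_mem_ball hz
  have hradius : ∑ l ∈ Finset.univ.erase m, ‖(M.map ((↑) : ℝ → ℂ))ᵀ m l‖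
      = ∑ l, M l m - M m m := by
    rw [← Finset.sum_erase_eq_sub (Finset.mem_univ m)]
    refine Finset.sum_congr rfl fun l hl => ?_
    rw [transpose_apply, map_apply, Complex.norm_real,
      Real.norm_of_nonneg (hM l m (Finset.ne_of_mem_erase hl))]
  rw [mem_closedBall_iff_norm, hradius] at hm
  have hre := (Complex.re_le_norm _).trans hm
  simp only [transpose_apply, map_apply, Complex.sub_re, Complex.ofReal_re] at hre
  linarith [hc m]

/-- Doeblin's bound: the part of the jumps that goes to `l` at rate `u l` from everywhere is the
rank-one perturbation `u 1ᵀ`, which only moves the eigenvalue `0`. -/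
theorem sum_le_norm_of_mem_roots_charpoly_erase {Q : Matrix ι ι ℝ} {u : ι → ℝ}
    (hQ : ∀ m, ∑ l, Q l m = 0) (hu : ∀ l m, l ≠ m → u l ≤ Q l m) {z : ℂ}
    (hz : z ∈ (Q.map ((↑) : ℝ → ℂ)).charpoly.roots.erase 0) : ∑ l, u l ≤ ‖z‖ := by
  cases isEmpty_or_nonempty ι
  · simp
  have hone : (1 : ι → ℂ) ᵥ* Q.map ((↑) : ℝ → ℂ) = 0 := by
    ext m
    simpa [vecMul, dotProduct] using congrArg ((↑) : ℝ → ℂ) (hQ m)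
  have hz' : z ∈ ((Q - vecMulVec u 1).map ((↑) : ℝ → ℂ)).charpoly.roots := by
    have hmap : (Q - vecMulVec u 1).map ((↑) : ℝ → ℂ)
        = Q.map ((↑) : ℝ → ℂ) - vecMulVec (fun l => (u l : ℂ)) 1 := by
      ext l m
      simp
    rw [hmap, roots_charpoly_sub_vecMulVec one_ne_zero hone]
    exact Multiset.mem_cons_of_mem hz
  have hre : z.re ≤ -∑ l, u l := by
    refine re_le_of_mem_roots_charpoly (fun l m hlm => ?_) (fun m => ?_) hz'
    · simpa [vecMulVec_apply] using hu l m hlm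
    · simp [Finset.sum_sub_distrib, hQ]
  linarith [(neg_le_abs _).trans (Complex.abs_re_le_norm z)]

end MarkovGenerator

/-! ### Spectral gaps -/

section SpectralGap

variable {V W : Type*} [AddCommGroup V] [Module ℂ V] [FiniteDimensional ℂ V]
  [AddCommGroup W] [Module ℂ W] [FiniteDimensional ℂ W]

theorem nonempty_norm_roots_charpoly_erase (T : V →ₗ[ℂ] V) (hV : 1 < Module.finrank ℂ V) :
    {r : ℝ | ∃ z ∈ T.charpoly.roots.erase 0, r = ‖z‖}.Nonempty := by
  have hcard : T.charpoly.roots.card = Module.finrank ℂ V := by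
    rw [IsAlgClosed.card_roots_eq_natDegree, LinearMap.charpoly_natDegree]
  have hpos : 0 < (T.charpoly.roots.erase 0).card := by
    have := Multiset.card_erase_add_one (s := T.charpoly.roots) (a := 0)
    by_cases h0 : (0 : ℂ) ∈ T.charpoly.roots
    · have := this h0
      omega
    · rw [Multiset.erase_of_notMem h0]
      omega
  obtain ⟨z, hz⟩ := Multiset.card_pos_iff_exists_mem.mp hpos
  exact ⟨‖z‖, z, hz, rfl⟩

theorem bddBelow_norm_roots_charpoly_erase (T : V →ₗ[ℂ] V) :
    BddBelow {r : ℝ | ∃ z ∈ T.charpoly.roots.erase 0, r = ‖z‖} :=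
  ⟨0, by rintro _ ⟨z, -, rfl⟩; exact norm_nonneg z⟩

theorem le_spectralGap {T : V →ₗ[ℂ] V} {r : ℝ} (hV : 1 < Module.finrank ℂ V)
    (h : ∀ z ∈ T.charpoly.roots.erase 0, r ≤ ‖z‖) : r ≤ spectralGap T :=
  le_csInf (nonempty_norm_roots_charpoly_erase T hV) (by rintro _ ⟨z, hz, rfl⟩; exact h z hz)

theorem spectralGap_conj (e : V ≃ₗ[ℂ] W) (T : V →ₗ[ℂ] V) :
    spectralGap (e.conj T) = spectralGap T := by
  rw [spectralGap, spectralGap, LinearEquiv.charpoly_conj]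

theorem roots_charpoly_toLin'_diagonal {ι : Type*} [Fintype ι] [DecidableEq ι] (d : ι → ℂ) :
    (Matrix.toLin' (Matrix.diagonal d)).charpoly.roots = Finset.univ.val.map d := by
  rw [Matrix.charpoly_toLin', Matrix.charpoly_diagonal,
    ← Polynomial.roots_multiset_prod_X_sub_C (Finset.univ.val.map d), Multiset.map_map]
  rfl

theorem spectralGap_prodMap_diagonal {ι : Type*} [Fintype ι] [DecidableEq ι] [Nonempty ι]
    {T : V →ₗ[ℂ] V} (hV : 1 < Module.finrank ℂ V) (h₀ : 0 ∈ T.charpoly.roots) (d : ι → ℂ) :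
    spectralGap (T.prodMap (Matrix.toLin' (Matrix.diagonal d)))
      = min (spectralGap T) (⨅ i, ‖d i‖) := by
  have hroots : (T.prodMap (Matrix.toLin' (Matrix.diagonal d))).charpoly.roots.erase 0
      = T.charpoly.roots.erase 0 + Finset.univ.val.map d := by
    rw [LinearMap.charpoly_prodMap, Polynomial.roots_mul
      (mul_ne_zero (LinearMap.charpoly_monic _).ne_zero (LinearMap.charpoly_monic _).ne_zero),
      roots_charpoly_toLin'_diagonal, Multiset.erase_add_left_pos _ h₀]
  have hunion : {r : ℝ | ∃ z ∈ T.charpoly.roots.erase 0 + Finset.univ.val.map d, r = ‖z‖}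
      = {r : ℝ | ∃ z ∈ T.charpoly.roots.erase 0, r = ‖z‖} ∪ Set.range fun i => ‖d i‖ := by
    ext r
    simp [or_and_right, exists_or, eq_comm]
  rw [spectralGap, hroots, hunion, csInf_union (bddBelow_norm_roots_charpoly_erase T)
    (nonempty_norm_roots_charpoly_erase T hV) (Set.finite_range _).bddBelow
    (Set.range_nonempty _)]
  rfl

end SpectralGap

/-! ### Filters and transition rates -/

section Filters

variable {β σ : ℝ}

theorem windowHat_neg (x : ℝ) : windowHat σ (-x) = windowHat σ x := by
  simp [windowHat]

@[fun_prop]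
theorem continuous_windowHat : Continuous (windowHat σ) := by
  unfold windowHat
  fun_prop

theorem windowHat_pos (hσ : 0 < σ) (x : ℝ) : 0 < windowHat σ x := by
  unfold windowHat
  positivity

theorem windowHat_le_windowHat_zero (x : ℝ) : windowHat σ x ≤ windowHat σ 0 := by
  refine mul_le_mul_of_nonneg_left (Real.exp_le_exp.mpr ?_) (by positivity)
  rw [zero_pow two_ne_zero, zero_div, neg_zero, neg_nonpos]
  positivity

theorem integrable_windowHat (hσ : 0 < σ) : Integrable (windowHat σ) := by
  refine ((integrable_exp_neg_mul_sq (b := 1 / (4 * σ ^ 2)) (by positivity)).const_mul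
    (1 / Real.sqrt (σ * Real.sqrt (2 * Real.pi)))).congr (Eventually.of_forall fun x => ?_)
  simp only [windowHat]
  congr 2
  ring

@[fun_prop]
theorem continuous_gam : Continuous (gam β σ) := by
  unfold gam
  fun_prop

theorem gam_pos (ω : ℝ) : 0 < gam β σ ω := Real.exp_pos _

theorem gam_le_one (hβ : 0 ≤ β) (ω : ℝ) : gam β σ ω ≤ 1 := by
  rw [gam, Real.exp_le_one_iff, neg_nonpos]
  positivity

theorem antitone_gam (hβ : 0 ≤ β) : Antitone (gam β σ) := fun a b h => by
  unfold gam
  gcongr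

theorem exp_le_gam {K C ν : ℝ} (hβ : 0 ≤ β) (hσ : 0 ≤ σ) (hK : β * σ ≤ K) (hν : β * ν ≤ C) :
    Real.exp (-max (C + K ^ 2 / 2) 0) ≤ gam β σ ν := by
  have hshift : β * (ν + β * σ ^ 2 / 2) ≤ C + K ^ 2 / 2 :=
    calc β * (ν + β * σ ^ 2 / 2) = β * ν + (β * σ) ^ 2 / 2 := by ring
      _ ≤ C + K ^ 2 / 2 := by gcongr
  rw [gam, mul_max_of_nonneg _ _ hβ, mul_zero]
  gcongr

theorem integrable_theta (hβ : 0 ≤ β) (hσ : 0 < σ) (ν₁ ν₂ : ℝ) :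
    Integrable fun ω => windowHat σ (ω - ν₁) * windowHat σ (ω - ν₂) * gam β σ ω := by
  refine Integrable.mono' (((integrable_windowHat hσ).comp_sub_right ν₁).mul_const
    (windowHat σ 0)) (by fun_prop) (Eventually.of_forall fun ω => ?_)
  have h₁ := windowHat_pos hσ (ω - ν₁)
  have h₂ := windowHat_pos hσ (ω - ν₂)
  rw [Real.norm_of_nonneg (mul_pos (mul_pos h₁ h₂) (gam_pos ω)).le]
  refine (mul_le_of_le_one_right (by positivity) (gam_le_one hβ ω)).trans ?_
  exact mul_le_mul_of_nonneg_left (windowHat_le_windowHat_zero _) h₁.le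

theorem windowHat_mul_self (hσ : 0 < σ) (x : ℝ) : windowHat σ x * windowHat σ x
    = 1 / (σ * Real.sqrt (2 * Real.pi)) * Real.exp (-(1 / (2 * σ ^ 2)) * x ^ 2) := by
  unfold windowHat
  rw [mul_mul_mul_comm, ← Real.exp_add, div_mul_div_comm, one_mul,
    Real.mul_self_sqrt (by positivity)]
  congr 2
  field_simp
  ring

theorem integrable_windowHat_mul_self (hσ : 0 < σ) :
    Integrable fun x => windowHat σ x * windowHat σ x := by
  simp_rw [windowHat_mul_self hσ]
  exact (integrable_exp_neg_mul_sq (by positivity)).const_mul _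

theorem integral_Ioi_windowHat_mul_self (hσ : 0 < σ) :
    ∫ x in Set.Ioi (0 : ℝ), windowHat σ x * windowHat σ x = 1 / 2 := by
  simp_rw [windowHat_mul_self hσ]
  rw [integral_const_mul, integral_gaussian_Ioi,
    show Real.pi / (1 / (2 * σ ^ 2)) = σ ^ 2 * (2 * Real.pi) by field_simp,
    Real.sqrt_mul (sq_nonneg σ) (2 * Real.pi), Real.sqrt_sq hσ.le]
  field_simp

/-- Half of the Gaussian weight lies at frequencies below `ν`, where the filter exceeds `γ(ν)`. -/
theorem half_gam_le_alpha (hβ : 0 ≤ β) (hσ : 0 < σ) (ν : ℝ) :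
    1 / 2 * gam β σ ν ≤ alpha β σ ν := by
  have hreflect : ∀ x, windowHat σ (ν - x - ν) = windowHat σ x := fun x => by
    rw [sub_sub_cancel_left, windowHat_neg]
  have hint : Integrable fun x => windowHat σ x * windowHat σ x * gam β σ (ν - x) := by
    simpa only [hreflect] using (integrable_theta hβ hσ ν ν).comp_sub_left ν
  calc 1 / 2 * gam β σ ν
      = ∫ x in Set.Ioi (0 : ℝ), windowHat σ x * windowHat σ x * gam β σ ν := by
        rw [integral_mul_const, integral_Ioi_windowHat_mul_self hσ]
    _ ≤ ∫ x in Set.Ioi (0 : ℝ), windowHat σ x * windowHat σ x * gam β σ (ν - x) := by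
        refine setIntegral_mono_on ((integrable_windowHat_mul_self hσ).integrableOn.mul_const _)
          hint.integrableOn measurableSet_Ioi fun x hx => ?_
        exact mul_le_mul_of_nonneg_left (antitone_gam hβ (sub_le_self ν (le_of_lt hx)))
          (mul_self_nonneg _)
    _ ≤ ∫ x, windowHat σ x * windowHat σ x * gam β σ (ν - x) :=
        setIntegral_le_integral hint (Eventually.of_forall fun x =>
          mul_nonneg (mul_self_nonneg _) (gam_pos _).le)
    _ = alpha β σ ν := by
        rw [eq_comm, alpha, theta, ← integral_sub_left_eq_self _ _ ν]
        simp only [hreflect]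

theorem alpha_pos (hβ : 0 ≤ β) (hσ : 0 < σ) (ν : ℝ) : 0 < alpha β σ ν :=
  (mul_pos one_half_pos (gam_pos ν)).trans_le (half_gam_le_alpha hβ hσ ν)

/-- Detailed balance. The reflection `ω ↦ -βσ² - ω` about the kink of `γ` matches the two
integrands up to the factor `e^{-βν}`. -/
theorem alpha_eq_exp_mul_alpha_neg (hσ : 0 < σ) (ν : ℝ) :
    alpha β σ ν = Real.exp (-(β * ν)) * alpha β σ (-ν) := by
  have hmax : ∀ y : ℝ, max (-y) 0 = max y 0 - y := fun y => by
    have := max_zero_sub_max_neg_zero_eq_self y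
    linarith
  have hkink : ∀ ω : ℝ, -(β * σ ^ 2) - ω + β * σ ^ 2 / 2 = -(ω + β * σ ^ 2 / 2) := fun ω => by
    ring
  rw [alpha, theta, alpha, theta, ← integral_sub_left_eq_self
    (fun ω => windowHat σ (ω - ν) * windowHat σ (ω - ν) * gam β σ ω) volume (-(β * σ ^ 2)),
    ← integral_const_mul]
  congr 1 with ω
  simp only [windowHat_mul_self hσ, gam, mul_assoc, ← Real.exp_add, hkink, hmax]
  rw [mul_left_comm, ← Real.exp_add]
  congr 2
  field_simp
  ring

theorem windowHat_normalization (hσ : 0 < σ) :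
    1 / Real.sqrt (2 * Real.pi)
        * (Real.sqrt (σ * Real.sqrt (2 / Real.pi)) * Real.sqrt (Real.pi / σ ^ 2))
      = 1 / Real.sqrt (σ * Real.sqrt (2 * Real.pi)) := by
  have hprod : Real.sqrt (2 / Real.pi) * Real.sqrt (2 * Real.pi) = 2 := by
    rw [← Real.sqrt_mul (by positivity),
      show 2 / Real.pi * (2 * Real.pi) = 2 ^ 2 by field_simp, Real.sqrt_sq zero_le_two]
  rw [eq_div_iff (by positivity), ← sq_eq_sq₀ (by positivity) (by positivity)]
  simp only [mul_pow, div_pow, one_pow]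
  rw [Real.sq_sqrt (by positivity), Real.sq_sqrt (by positivity), Real.sq_sqrt (by positivity),
    Real.sq_sqrt (by positivity)]
  calc _ = (Real.sqrt (2 / Real.pi) * Real.sqrt (2 * Real.pi)) * (1 / 2) := by field_simp
    _ = 1 := by rw [hprod]; norm_num

theorem integral_window_mul_exp (hσ : 0 < σ) (ω ν : ℝ) :
    ((1 / Real.sqrt (2 * Real.pi) : ℝ) : ℂ) * ∫ t : ℝ, Complex.exp (-(Complex.I * ω * t)) *
      (window σ t : ℂ) * Complex.exp (Complex.I * t * ν) = (windowHat σ (ω - ν) : ℂ) := by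
  have hgauss : ∀ t : ℝ, Complex.exp (-(Complex.I * ω * t)) * (window σ t : ℂ) *
      Complex.exp (Complex.I * t * ν) = (Real.sqrt (σ * Real.sqrt (2 / Real.pi)) : ℂ) *
      (Complex.exp (Complex.I * ((ν - ω : ℝ) : ℂ) * t) *
        Complex.exp (-((σ ^ 2 : ℝ) : ℂ) * t ^ 2)) := fun t => by
    simp only [window, Complex.ofReal_mul, Complex.ofReal_exp]
    rw [← Complex.exp_add, mul_right_comm, ← mul_assoc, ← Complex.exp_add, ← Complex.exp_add,
      mul_comm]
    congr 2
    push_cast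
    ring
  have hsqrt : ((Real.pi : ℂ) / ((σ ^ 2 : ℝ) : ℂ)) ^ (1 / 2 : ℂ)
      = (Real.sqrt (Real.pi / σ ^ 2) : ℂ) := by
    rw [Real.sqrt_eq_rpow, Complex.ofReal_cpow (by positivity)]
    push_cast
    rfl
  have hexp : Complex.exp (-((ν - ω : ℝ) : ℂ) ^ 2 / (4 * ((σ ^ 2 : ℝ) : ℂ)))
      = (Real.exp (-((ω - ν) ^ 2 / (4 * σ ^ 2))) : ℂ) := by
    push_cast
    congr 1
    ring
  have hre : 0 < ((σ ^ 2 : ℝ) : ℂ).re := by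
    rw [Complex.ofReal_re]
    positivity
  simp_rw [hgauss]
  rw [integral_const_mul, fourierIntegral_gaussian hre, hsqrt, hexp, windowHat,
    ← windowHat_normalization hσ]
  push_cast
  ring

theorem integrable_window_mul_exp (hσ : 0 < σ) (ω ν : ℝ) :
    Integrable fun t : ℝ => Complex.exp (-(Complex.I * ω * t)) * (window σ t : ℂ) *
      Complex.exp (Complex.I * t * ν) := by
  by_contra h
  have hzero := integral_window_mul_exp hσ ω ν
  rw [integral_undef h, mul_zero, eq_comm, Complex.ofReal_eq_zero] at hzero
  exact (windowHat_pos hσ _).ne' hzero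

end Filters

/-! ### Matrix elements -/

section Ketbra

theorem conjTranspose_ketbra (x y : EuclideanSpace ℂ (Fin n)) : (ketbra x y)ᴴ = ketbra y x := by
  rw [ketbra, Matrix.conjTranspose_vecMulVec, star_star, ketbra]

theorem trace_ketbra (x y : EuclideanSpace ℂ (Fin n)) : (ketbra x y).trace = inner ℂ y x := by
  rw [ketbra, Matrix.trace_vecMulVec, EuclideanSpace.inner_eq_star_dotProduct]

theorem ketbra_mul_ketbra (x y z w : EuclideanSpace ℂ (Fin n)) :
    ketbra x y * ketbra z w = inner ℂ y z • ketbra x w := by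
  rw [ketbra, ketbra, Matrix.vecMulVec_mul_vecMulVec, EuclideanSpace.inner_eq_star_dotProduct,
    dotProduct_comm, Matrix.vecMulVec_smul]
  rfl

/-- The matrix element `⟨x|A|y⟩`, as a linear functional of `A`. -/
noncomputable def matrixElement (x y : EuclideanSpace ℂ (Fin n)) : Mat n →L[ℂ] ℂ :=
  LinearMap.toContinuousLinearMap
    { toFun := fun A => star x.ofLp ⬝ᵥ A *ᵥ y.ofLp
      map_add' := fun A B => by rw [Matrix.add_mulVec, dotProduct_add]
      map_smul' := fun c A => by rw [Matrix.smul_mulVec, dotProduct_smul, RingHom.id_apply] }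

theorem matrixElement_apply (x y : EuclideanSpace ℂ (Fin n)) (A : Mat n) :
    matrixElement x y A = star x.ofLp ⬝ᵥ A *ᵥ y.ofLp := rfl

theorem matrixElement_one (x y : EuclideanSpace ℂ (Fin n)) : matrixElement x y 1 = inner ℂ x y := by
  rw [matrixElement_apply, Matrix.one_mulVec, EuclideanSpace.inner_eq_star_dotProduct,
    dotProduct_comm]

theorem ketbra_mul_mul_ketbra (a x y b : EuclideanSpace ℂ (Fin n)) (A : Mat n) :
    ketbra a x * A * ketbra y b = matrixElement x y A • ketbra a b := by
  rw [ketbra, ketbra, mul_assoc, Matrix.mul_vecMulVec, Matrix.vecMulVec_mul_vecMulVec,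
    Matrix.vecMulVec_smul]
  rfl

theorem matrixElement_ketbra (x y z w : EuclideanSpace ℂ (Fin n)) :
    matrixElement x y (ketbra z w) = inner ℂ x z * inner ℂ w y := by
  simp only [matrixElement_apply, ketbra, Matrix.vecMulVec_mulVec,
    EuclideanSpace.inner_eq_star_dotProduct, dotProduct_smul, op_smul_eq_smul, smul_eq_mul]
  rw [mul_comm, dotProduct_comm (star x.ofLp), dotProduct_comm (star w.ofLp)]

theorem matrixElement_mul_ketbra_mul_conjTranspose (x x' y y' : EuclideanSpace ℂ (Fin n))
    (A : Mat n) :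
    matrixElement x x' (A * ketbra y y' * Aᴴ)
      = matrixElement x y A * star (matrixElement x' y' A) := by
  simp only [matrixElement_apply, ketbra, Matrix.mul_vecMulVec, Matrix.vecMulVec_mul,
    ← Matrix.star_mulVec, Matrix.vecMulVec_mulVec, dotProduct_smul, op_smul_eq_smul, smul_eq_mul]
  rw [mul_comm, ← Matrix.star_dotProduct]

end Ketbra

section Basis

variable (v : OrthonormalBasis (Fin n) ℂ (EuclideanSpace ℂ (Fin n)))

theorem sum_ketbra_basis : ∑ l, ketbra (v l) (v l) = 1 := by
  refine Matrix.ext_of_mulVec_single fun i => ?_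
  have hrepr := congrArg WithLp.ofLp (v.sum_repr (EuclideanSpace.single i 1))
  simp only [WithLp.ofLp_sum, WithLp.ofLp_smul, v.repr_apply_apply] at hrepr
  rw [Matrix.one_mulVec, Matrix.sum_mulVec]
  refine Eq.trans (Finset.sum_congr rfl fun l _ => ?_) hrepr
  ext j
  simp [ketbra, EuclideanSpace.inner_eq_star_dotProduct, Matrix.vecMulVec_apply, mul_comm]

theorem sum_matrixElement_smul_ketbra (A : Mat n) :
    ∑ p : Fin n × Fin n, matrixElement (v p.1) (v p.2) A • ketbra (v p.1) (v p.2) = A := by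
  simp_rw [Fintype.sum_prod_type, ← ketbra_mul_mul_ketbra, ← Finset.mul_sum, sum_ketbra_basis,
    mul_one, ← Finset.sum_mul, sum_ketbra_basis, one_mul]

theorem ext_matrixElement {A B : Mat n}
    (h : ∀ l m, matrixElement (v l) (v m) A = matrixElement (v l) (v m) B) : A = B := by
  rw [← sum_matrixElement_smul_ketbra v A, ← sum_matrixElement_smul_ketbra v B]
  simp only [h]

end Basis

/-! ### First moments of unitary 1-designs -/

section Design

theorem integrable_of_continuous {X E : Type*} [TopologicalSpace X] [CompactSpace X]
    [MeasurableSpace X] [OpensMeasurableSpace X] [NormedAddCommGroup E] {μ : Measure X}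
    [IsFiniteMeasureOnCompacts μ] {F : X → E} (hF : Continuous F) : Integrable F μ :=
  hF.integrable_of_hasCompactSupport (.of_compactSpace F)

theorem exists_eq_smul_one_of_commute_unitary {T : Mat n}
    (hT : ∀ W : U n, Commute (W : Mat n) T) : ∃ c : ℂ, T = c • 1 := by
  have hcomm : ∀ X : Mat n, Commute X T := fun X => by
    have hX : X ∈ Submodule.span ℂ (unitary (Mat n) : Set (Mat n)) := by
      rw [CStarAlgebra.span_unitary]
      exact Submodule.mem_top
    induction hX using Submodule.span_induction with
    | mem W hW => exact hT ⟨W, hW⟩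
    | zero => exact Commute.zero_left T
    | add _ _ _ _ h₁ h₂ => exact h₁.add_left h₂
    | smul c _ _ h => exact h.smul_left c
  obtain ⟨c, rfl⟩ := (Algebra.IsCentral.mem_center_iff ℂ).mp (Subalgebra.mem_center_iff.mpr hcomm)
  exact ⟨c, Algebra.algebraMap_eq_smul_one c⟩

theorem commute_integral_haarU_conj (X : Mat n) (W : U n) :
    Commute (W : Mat n) (∫ V : U n, (V : Mat n) * X * (V : Mat n)ᴴ ∂(haarU n)) := by
  have : (haarU n).IsMulLeftInvariant := by
    unfold haarU
    infer_instance
  set T := ∫ V : U n, (V : Mat n) * X * (V : Mat n)ᴴ ∂(haarU n) with hT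
  have hinv : (W : Mat n) * T * (W : Mat n)ᴴ = T := by
    have hcomp := (sandwich (W : Mat n) (W : Mat n)ᴴ).integral_comp_comm (μ := haarU n)
      (φ := fun V : U n => (V : Mat n) * X * (V : Mat n)ᴴ) (integrable_of_continuous (by fun_prop))
    rw [sandwich_apply] at hcomp
    rw [hT, ← hcomp,
      ← integral_mul_left_eq_self (fun V : U n => (V : Mat n) * X * (V : Mat n)ᴴ) W]
    simp [sandwich_apply, mul_assoc]
  calc (W : Mat n) * T = W * T * ((W : Mat n)ᴴ * W) := by
        rw [← Matrix.star_eq_conjTranspose, Matrix.mem_unitaryGroup_iff'.mp W.2, mul_one]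
    _ = T * W := by rw [← mul_assoc, hinv]

theorem trace_integral_conj (D : Measure (U n)) [IsProbabilityMeasure D] (X : Mat n) :
    (∫ V : U n, (V : Mat n) * X * (V : Mat n)ᴴ ∂D).trace = X.trace := by
  have hcomp := (Matrix.traceLinearMap (Fin n) ℂ ℂ).toContinuousLinearMap.integral_comp_comm
    (μ := D) (φ := fun V : U n => (V : Mat n) * X * (V : Mat n)ᴴ)
    (integrable_of_continuous (by fun_prop))
  have htrace : ∀ V : U n, ((V : Mat n) * X * (V : Mat n)ᴴ).trace = X.trace := fun V => by
    rw [Matrix.trace_mul_comm, ← mul_assoc, ← Matrix.star_eq_conjTranspose,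
      Matrix.mem_unitaryGroup_iff'.mp V.2, one_mul]
  simp only [LinearMap.coe_toContinuousLinearMap', Matrix.traceLinearMap_apply, htrace,
    integral_const, probReal_univ, one_smul] at hcomp
  exact hcomp.symm

theorem integral_haarU_conj (X : Mat n) :
    ∫ V : U n, (V : Mat n) * X * (V : Mat n)ᴴ ∂(haarU n) = (X.trace / n) • (1 : Mat n) := by
  obtain ⟨c, hc⟩ := exists_eq_smul_one_of_commute_unitary (commute_integral_haarU_conj X)
  rcases Nat.eq_zero_or_pos n with rfl | hn
  · exact Subsingleton.elim _ _
  have hn₀ : (n : ℂ) ≠ 0 := Nat.cast_ne_zero.mpr hn.ne'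
  rw [← trace_integral_conj (haarU n) X, hc]
  simp [hn₀]

variable {D : Measure (U n)} (hD : IsUnitaryOneDesign D)

include hD in
theorem IsUnitaryOneDesign.integral_conj (X : Mat n) :
    ∫ V : U n, (V : Mat n) * X * (V : Mat n)ᴴ ∂D = (X.trace / n) • (1 : Mat n) :=
  (hD X).trans (integral_haarU_conj X)

variable [IsProbabilityMeasure D]

include hD in
theorem IsUnitaryOneDesign.integral_matrixElement_mul_star
    (x y x' y' : EuclideanSpace ℂ (Fin n)) :
    ∫ V : U n, matrixElement x y V * star (matrixElement x' y' V) ∂D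
      = inner ℂ y' y / n * inner ℂ x x' := by
  have hcomp := (matrixElement x x').integral_comp_comm (μ := D)
    (φ := fun V : U n => (V : Mat n) * ketbra y y' * (V : Mat n)ᴴ)
    (integrable_of_continuous (by fun_prop))
  simpa only [matrixElement_mul_ketbra_mul_conjTranspose, hD.integral_conj, map_smul, trace_ketbra,
    matrixElement_one, smul_eq_mul] using hcomp

variable {F : Type*} [NormedAddCommGroup F] [NormedSpace ℂ F]
  (v : OrthonormalBasis (Fin n) ℂ (EuclideanSpace ℂ (Fin n)))
  (G : Fin n × Fin n → Fin n × Fin n → F)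

theorem integrable_matrixElement_mul_star_smul (p q : Fin n × Fin n) :
    Integrable (fun V : U n => (matrixElement (v p.1) (v p.2) V
      * star (matrixElement (v q.1) (v q.2) V)) • G p q) D :=
  integrable_of_continuous (by fun_prop)

theorem integrable_sum_matrixElement_mul_star_smul :
    Integrable (fun V : U n => ∑ p, ∑ q,
      (matrixElement (v p.1) (v p.2) V * star (matrixElement (v q.1) (v q.2) V)) • G p q) D :=
  integrable_finsetSum _ fun p _ => integrable_finsetSum _ fun q _ =>
    integrable_matrixElement_mul_star_smul v G p q

include hD in
/-- A 1-design makes different matrix elements uncorrelated, so that it keeps only the diagonal of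
a quadratic form in the matrix elements. -/
theorem IsUnitaryOneDesign.integral_sum_matrixElement_mul_star_smul [CompleteSpace F] :
    ∫ V : U n, ∑ p, ∑ q,
      (matrixElement (v p.1) (v p.2) V * star (matrixElement (v q.1) (v q.2) V)) • G p q ∂D
      = (1 / n : ℂ) • ∑ p, G p p := by
  have hcov : ∀ p q : Fin n × Fin n, ∫ V : U n, matrixElement (v p.1) (v p.2) V
      * star (matrixElement (v q.1) (v q.2) V) ∂D = if p = q then (1 / n : ℂ) else 0 := by
    rintro ⟨l, m⟩ ⟨l', m'⟩
    rw [hD.integral_matrixElement_mul_star, v.inner_eq_ite, v.inner_eq_ite]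
    by_cases hl : l = l' <;> by_cases hm : m = m' <;> simp [hl, hm, Ne.symm]
  have hint := integrable_matrixElement_mul_star_smul (D := D) v G
  rw [integral_finsetSum _ fun p _ => integrable_finsetSum _ fun q _ => hint p q,
    Finset.smul_sum]
  refine Finset.sum_congr rfl fun p _ => ?_
  rw [integral_finsetSum _ fun q _ => hint p q]
  simp_rw [integral_smul_const, hcov, ite_smul, zero_smul, Finset.sum_ite_eq, Finset.mem_univ,
    if_true]

end Design

/-! ### The operator Fourier transform in an energy eigenbasis -/

theorem exp_mul_eq_smul_of_mul_eq_smul {𝔸 : Type*} [NormedRing 𝔸] [NormedAlgebra ℂ 𝔸]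
    [CompleteSpace 𝔸] {a x : 𝔸} {c : ℂ} (h : a * x = c • x) :
    NormedSpace.exp a * x = Complex.exp c • x := by
  have hpow : ∀ k : ℕ, a ^ k * x = c ^ k • x := fun k => by
    induction k with
    | zero => simp
    | succ k ih => rw [pow_succ, mul_assoc, h, mul_smul_comm, ih, smul_smul, pow_succ, mul_comm c]
  have hleft := (NormedSpace.exp_series_hasSum_exp' (𝕂 := ℂ) a).mul_right x
  have hright := (NormedSpace.exp_series_hasSum_exp' (𝕂 := ℂ) c).smul_const x
  rw [← Complex.exp_eq_exp_ℂ] at hright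
  refine hleft.unique (hright.congr_fun fun k => ?_)
  rw [smul_mul_assoc, hpow, smul_assoc]

section Eigenbasis

variable {v : OrthonormalBasis (Fin n) ℂ (EuclideanSpace ℂ (Fin n))} {H : Mat n} {E : Fin n → ℝ}
  (hv : ∀ j, Matrix.toEuclideanLin H (v j) = (E j : ℂ) • v j) (hH : H.IsHermitian)

include hv in
theorem exp_smul_mul_ketbra (s : ℂ) (j : Fin n) (y : EuclideanSpace ℂ (Fin n)) :
    NormedSpace.exp (s • H) * ketbra (v j) y = Complex.exp (s * E j) • ketbra (v j) y := by
  have hvec : H *ᵥ (v j).ofLp = (E j : ℂ) • (v j).ofLp := congrArg WithLp.ofLp (hv j)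
  refine exp_mul_eq_smul_of_mul_eq_smul ?_
  rw [smul_mul_assoc, ketbra, Matrix.mul_vecMulVec, hvec, Matrix.smul_vecMulVec, smul_smul]

include hv hH in
theorem ketbra_mul_exp_smul (s : ℂ) (x : EuclideanSpace ℂ (Fin n)) (j : Fin n) :
    ketbra x (v j) * NormedSpace.exp (s • H) = Complex.exp (s * E j) • ketbra x (v j) := by
  have h := congrArg Matrix.conjTranspose (exp_smul_mul_ketbra hv (star s) j x)
  rw [Matrix.conjTranspose_mul, conjTranspose_ketbra, ← Matrix.exp_conjTranspose] at h
  simpa [conjTranspose_ketbra, hH.eq, ← Complex.exp_conj] using h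

include hv hH in
theorem heisenberg_eq_sum (A : Mat n) (t : ℝ) :
    NormedSpace.exp ((Complex.I * t) • H) * A * NormedSpace.exp (-((Complex.I * t) • H))
      = ∑ p : Fin n × Fin n, (Complex.exp (Complex.I * t * (E p.1 - E p.2 : ℝ))
          * matrixElement (v p.1) (v p.2) A) • ketbra (v p.1) (v p.2) := by
  conv_lhs => rw [← sum_matrixElement_smul_ketbra v A, Finset.mul_sum, Finset.sum_mul, ← neg_smul]
  refine Finset.sum_congr rfl fun p _ => ?_
  rw [mul_smul_comm, smul_mul_assoc, exp_smul_mul_ketbra hv, smul_mul_assoc,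
    ketbra_mul_exp_smul hv hH, smul_smul, smul_smul, mul_assoc, ← Complex.exp_add, mul_comm]
  congr 3
  push_cast
  ring

include hv hH in
theorem oft_eq_sum {σ : ℝ} (hσ : 0 < σ) (A : Mat n) (ω : ℝ) :
    oft H σ A ω = ∑ p : Fin n × Fin n, ((windowHat σ (ω - (E p.1 - E p.2)) : ℂ)
      * matrixElement (v p.1) (v p.2) A) • ketbra (v p.1) (v p.2) := by
  simp_rw [oft, heisenberg_eq_sum hv hH, Finset.smul_sum, smul_smul, ← mul_assoc]
  rw [integral_finsetSum _ fun p _ =>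
    ((integrable_window_mul_exp hσ _ _).mul_const _).smul_const _, Finset.smul_sum]
  refine Finset.sum_congr rfl fun p _ => ?_
  rw [integral_smul_const, integral_mul_const, smul_smul, ← mul_assoc, integral_window_mul_exp hσ]

end Eigenbasis

/-! ### The Lindbladian as a quadratic form in the jump operator -/

theorem comm_apply (X N : Mat n) : comm X N = X * N - N * X := by
  simp [comm, sandwich_apply]

theorem anticomm_apply (X N : Mat n) : anticomm X N = X * N + N * X := by
  simp [anticomm, sandwich_apply]

theorem isLinearMap_comm : IsLinearMap ℂ (comm : Mat n → Superop n) where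
  map_add X Y := by ext1 N; simp [comm_apply, add_mul, mul_add]; abel
  map_smul c X := by ext1 N; simp [comm_apply, smul_sub]

/-- The dissipator `N ↦ X N W - ½ {W X, N}`, with `X†` replaced by an independent argument `W` to
make it bilinear. -/
noncomputable def dissipator : Mat n →ₗ[ℂ] Mat n →ₗ[ℂ] Superop n :=
  LinearMap.mk₂ ℂ (fun X W => sandwich X W - (1 / 2 : ℂ) • anticomm (W * X))
    (fun X Y W => by ext1 N; simp [sandwich_apply, anticomm_apply, add_mul, mul_add]; module)
    (fun c X W => by ext1 N; simp [sandwich_apply, anticomm_apply]; module)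
    (fun X W Z => by ext1 N; simp [sandwich_apply, anticomm_apply, add_mul, mul_add]; module)
    (fun c X W => by ext1 N; simp [sandwich_apply, anticomm_apply]; module)

theorem dissipator_apply (X W N : Mat n) :
    dissipator X W N = X * N * W - (1 / 2 : ℂ) • (W * X * N + N * (W * X)) := by
  simp [dissipator, sandwich_apply, anticomm_apply]

theorem dissipator_sum_conjTranspose {κ : Type*} [Fintype κ] (a : κ → ℂ) (X : κ → Mat n) :
    dissipator (∑ p, a p • X p) (∑ p, a p • X p)ᴴ
      = ∑ p, ∑ q, (a p * star (a q)) • dissipator (X p) (X q)ᴴ := by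
  simp only [Matrix.conjTranspose_sum, Matrix.conjTranspose_smul, map_sum, map_smul,
    LinearMap.sum_apply, LinearMap.smul_apply, Finset.smul_sum, smul_smul]
  rw [Finset.sum_comm]
  simp only [mul_comm (star _)]

section Lindbladian

variable {v : OrthonormalBasis (Fin n) ℂ (EuclideanSpace ℂ (Fin n))} {H : Mat n} {E : Fin n → ℝ}
  (hv : ∀ j, Matrix.toEuclideanLin H (v j) = (E j : ℂ) • v j) (hH : H.IsHermitian) {β σ : ℝ}

theorem integral_ofReal_sum_smul {κ F : Type*} [Fintype κ] [NormedAddCommGroup F]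
    [NormedSpace ℂ F] [CompleteSpace F] {f : κ → κ → ℝ → ℝ}
    (hf : ∀ p q, Integrable (f p q)) (X : κ → κ → F) :
    ∫ ω, ∑ p, ∑ q, (f p q ω : ℂ) • X p q = ∑ p, ∑ q, ((∫ ω, f p q ω : ℝ) : ℂ) • X p q := by
  have hint : ∀ p q, Integrable fun ω => (f p q ω : ℂ) • X p q := fun p q =>
    Integrable.smul_const (hf p q).ofReal (X p q)
  rw [integral_finsetSum _ fun p _ => integrable_finsetSum _ fun q _ => hint p q]
  refine Finset.sum_congr rfl fun p _ => ?_
  rw [integral_finsetSum _ fun q _ => hint p q]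
  simp_rw [integral_smul_const, integral_complex_ofReal]

include hv in
theorem jumpLindbladian_eq (hβ : 0 ≤ β) (hσ : 0 < σ) (V : U n) :
    jumpLindbladian hH β σ V
      = (-Complex.I) • comm (coherentB hH β σ fun _ : Unit => (V : Mat n)) +
        ∑ p : Fin n × Fin n, ∑ q : Fin n × Fin n,
          (matrixElement (v p.1) (v p.2) V * star (matrixElement (v q.1) (v q.2) V)) •
            ((theta β σ (E p.1 - E p.2) (E q.1 - E q.2) : ℂ) •
              dissipator (ketbra (v p.1) (v p.2)) (ketbra (v q.1) (v q.2))ᴴ) := by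
  have hdiss : ∀ ω : ℝ, (gam β σ ω : ℂ) • dissipator (oft H σ V ω) (oft H σ V ω)ᴴ
      = ∑ p : Fin n × Fin n, ∑ q : Fin n × Fin n,
        ((windowHat σ (ω - (E p.1 - E p.2)) * windowHat σ (ω - (E q.1 - E q.2))
          * gam β σ ω : ℝ) : ℂ) •
          ((matrixElement (v p.1) (v p.2) V * star (matrixElement (v q.1) (v q.2) V)) •
            dissipator (ketbra (v p.1) (v p.2)) (ketbra (v q.1) (v q.2))ᴴ) := fun ω => by
    rw [oft_eq_sum hv hH hσ, dissipator_sum_conjTranspose]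
    simp only [Finset.smul_sum, smul_smul, star_mul', Complex.star_def, Complex.conj_ofReal,
      Complex.ofReal_mul]
    refine Finset.sum_congr rfl fun p _ => Finset.sum_congr rfl fun q _ => ?_
    congr 1
    ring
  rw [jumpLindbladian, lindbladian, Fintype.sum_unique]
  congr 1
  refine (integral_congr_ae (.of_forall hdiss)).trans ?_
  rw [integral_ofReal_sum_smul (fun p q => integrable_theta hβ hσ _ _)]
  simp only [theta, smul_comm (matrixElement _ _ _ * _)]

end Lindbladian

section Coherent

variable {H : Mat n} (hH : H.IsHermitian) (β σ : ℝ)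

theorem toEuclideanLin_eigenvectorBasis (j : Fin n) :
    Matrix.toEuclideanLin H (hH.eigenvectorBasis j)
      = (hH.eigenvalues j : ℂ) • hH.eigenvectorBasis j := by
  ext i
  simpa using congrFun (hH.mulVec_eigenvectorBasis j) i

theorem bohrComponent_eq_sum (A : Mat n) (ν : ℝ) :
    bohrComponent hH A ν
      = ∑ p : Fin n × Fin n with hH.eigenvalues p.1 - hH.eigenvalues p.2 = ν,
        matrixElement (hH.eigenvectorBasis p.1) (hH.eigenvectorBasis p.2) A •
          ketbra (hH.eigenvectorBasis p.1) (hH.eigenvectorBasis p.2) := by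
  simp_rw [bohrComponent, Finset.sum_filter, Fintype.sum_prod_type, ketbra_mul_mul_ketbra]

/-- The coefficient of `(A_{ν₂})† A_{ν₁}` in the coherent term `B`. -/
noncomputable def coherentCoeff (ν₁ ν₂ : ℝ) : ℂ :=
  ((Real.tanh (-(β * (ν₁ - ν₂)) / 4) * theta β σ ν₁ ν₂ : ℝ) : ℂ) / (2 * Complex.I)

theorem coherentB_eq_sum (A : Mat n) :
    coherentB hH β σ (fun _ : Unit => A) = ∑ p : Fin n × Fin n, ∑ q : Fin n × Fin n,
      (matrixElement (hH.eigenvectorBasis p.1) (hH.eigenvectorBasis p.2) A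
        * star (matrixElement (hH.eigenvectorBasis q.1) (hH.eigenvectorBasis q.2) A)) •
      (coherentCoeff β σ (hH.eigenvalues p.1 - hH.eigenvalues p.2)
          (hH.eigenvalues q.1 - hH.eigenvalues q.2) •
        ((ketbra (hH.eigenvectorBasis q.1) (hH.eigenvectorBasis q.2))ᴴ
          * ketbra (hH.eigenvectorBasis p.1) (hH.eigenvectorBasis p.2))) := by
  have hmem : ∀ p ∈ (Finset.univ : Finset (Fin n × Fin n)),
      hH.eigenvalues p.1 - hH.eigenvalues p.2 ∈ bohrFrequencies hH :=
    fun p hp => Finset.mem_image_of_mem _ hp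
  rw [coherentB, Fintype.sum_unique, ← Finset.sum_fiberwise_of_maps_to hmem]
  refine Finset.sum_congr rfl fun ν₁ _ => ?_
  simp_rw [← Finset.sum_fiberwise_of_maps_to hmem]
  rw [Finset.sum_comm]
  refine Finset.sum_congr rfl fun ν₂ _ => ?_
  rw [bohrComponent_eq_sum, bohrComponent_eq_sum, Matrix.conjTranspose_sum, Finset.sum_mul_sum,
    Finset.sum_comm, Finset.smul_sum]
  refine Finset.sum_congr rfl fun p hp => ?_
  rw [Finset.smul_sum]
  refine Finset.sum_congr rfl fun q hq => ?_
  rw [(Finset.mem_filter.mp hp).2, (Finset.mem_filter.mp hq).2, Matrix.conjTranspose_smul,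
    smul_mul_smul_comm, smul_comm, mul_comm (star _), coherentCoeff]

theorem coherentCoeff_self (ν : ℝ) : coherentCoeff β σ ν ν = 0 := by
  simp [coherentCoeff]

theorem comm_coherentB_eq_sum (A : Mat n) :
    comm (coherentB hH β σ fun _ : Unit => A) = ∑ p : Fin n × Fin n, ∑ q : Fin n × Fin n,
      (matrixElement (hH.eigenvectorBasis p.1) (hH.eigenvectorBasis p.2) A
        * star (matrixElement (hH.eigenvectorBasis q.1) (hH.eigenvectorBasis q.2) A)) •
      (coherentCoeff β σ (hH.eigenvalues p.1 - hH.eigenvalues p.2)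
          (hH.eigenvalues q.1 - hH.eigenvalues q.2) •
        comm ((ketbra (hH.eigenvectorBasis q.1) (hH.eigenvectorBasis q.2))ᴴ
          * ketbra (hH.eigenvectorBasis p.1) (hH.eigenvectorBasis p.2))) := by
  have hcomm : ∀ X : Mat n, comm X = isLinearMap_comm.mk' comm X := fun _ => rfl
  simp only [coherentB_eq_sum, hcomm, map_sum, map_smul]

variable {D : Measure (U n)} [IsProbabilityMeasure D]

theorem integrable_comm_coherentB :
    Integrable (fun V : U n => comm (coherentB hH β σ fun _ : Unit => (V : Mat n))) D := by
  simp_rw [comm_coherentB_eq_sum]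
  exact integrable_sum_matrixElement_mul_star_smul (F := Superop n) _ _

theorem IsUnitaryOneDesign.integral_comm_coherentB (hD : IsUnitaryOneDesign D) :
    ∫ V : U n, comm (coherentB hH β σ fun _ : Unit => (V : Mat n)) ∂D = 0 := by
  simp_rw [comm_coherentB_eq_sum]
  rw [hD.integral_sum_matrixElement_mul_star_smul (F := Superop n) hH.eigenvectorBasis]
  refine (congrArg _ (Finset.sum_eq_zero fun p _ => ?_)).trans (smul_zero _)
  rw [coherentCoeff_self]
  exact zero_smul ℂ (comm _)

end Coherent

section Average

variable {v : OrthonormalBasis (Fin n) ℂ (EuclideanSpace ℂ (Fin n))} {H : Mat n} {E : Fin n → ℝ}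
  (hv : ∀ j, Matrix.toEuclideanLin H (v j) = (E j : ℂ) • v j) (hH : H.IsHermitian) {β σ : ℝ}
  {D : Measure (U n)} [IsProbabilityMeasure D]

theorem integrable_jumpLindbladian (hβ : 0 ≤ β) (hσ : 0 < σ) :
    Integrable (fun V : U n => jumpLindbladian hH β σ V) D := by
  simp_rw [jumpLindbladian_eq (toEuclideanLin_eigenvectorBasis hH) hH hβ hσ]
  exact ((integrable_comm_coherentB hH β σ).fun_smul (β := Superop n) (-Complex.I)).add
    (integrable_sum_matrixElement_mul_star_smul (F := Superop n) _ _)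

include hv in
theorem averageLindbladian_eq_sum (hD : IsUnitaryOneDesign D) (hβ : 0 ≤ β) (hσ : 0 < σ) :
    averageLindbladian hH β σ D = (1 / n : ℂ) • ∑ p : Fin n × Fin n,
      (alpha β σ (E p.1 - E p.2) : ℂ) •
        dissipator (ketbra (v p.1) (v p.2)) (ketbra (v p.2) (v p.1)) := by
  unfold averageLindbladian
  simp_rw [jumpLindbladian_eq hv hH hβ hσ]
  rw [integral_add ((integrable_comm_coherentB hH β σ).fun_smul (β := Superop n) (-Complex.I))
    (integrable_sum_matrixElement_mul_star_smul (F := Superop n) _ _), integral_smul,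
    hD.integral_comm_coherentB, smul_zero, zero_add,
    hD.integral_sum_matrixElement_mul_star_smul v]
  simp_rw [conjTranspose_ketbra, alpha]

end Average

/-! ### Classical and dephasing parts -/

section Rates

variable {β σ : ℝ}

theorem dephasingRate_self (β σ : ℝ) (E : Fin n → ℝ) (m : Fin n) :
    dephasingRate β σ E m m = ∑ j, alpha β σ (E j - E m) / n := by
  rw [dephasingRate, ← Finset.sum_div, Finset.sum_add_distrib]
  ring

theorem classicalGenerator_eq (β σ : ℝ) (E : Fin n → ℝ) (l m : Fin n) :
    classicalGenerator β σ E l m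
      = alpha β σ (E l - E m) / n - if l = m then dephasingRate β σ E l m else 0 := by
  by_cases h : l = m
  · subst h
    simp [classicalGenerator, dephasingRate_self]
  · simp [classicalGenerator, h]

theorem classicalGenerator_of_ne (β σ : ℝ) (E : Fin n → ℝ) {l m : Fin n} (h : l ≠ m) :
    classicalGenerator β σ E l m = alpha β σ (E l - E m) / n := by
  rw [classicalGenerator_eq, if_neg h, sub_zero]

theorem classicalGenerator_pos (hβ : 0 ≤ β) (hσ : 0 < σ) (E : Fin n → ℝ) {l m : Fin n}
    (h : l ≠ m) : 0 < classicalGenerator β σ E l m := by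
  rw [classicalGenerator_of_ne β σ E h]
  exact div_pos (alpha_pos hβ hσ _) (Nat.cast_pos.mpr l.pos)

theorem sum_classicalGenerator (β σ : ℝ) (E : Fin n → ℝ) (m : Fin n) :
    ∑ l, classicalGenerator β σ E l m = 0 := by
  simp_rw [classicalGenerator_eq, Finset.sum_sub_distrib]
  simp [dephasingRate_self]

theorem classicalGenerator_mul_gibbs (β : ℝ) (hσ : 0 < σ) (E : Fin n → ℝ) (l m : Fin n) :
    classicalGenerator β σ E l m * gibbs β E m = classicalGenerator β σ E m l * gibbs β E l := by
  obtain rfl | h := eq_or_ne l m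
  · rfl
  have hexp : Real.exp (-(β * E l)) = Real.exp (-(β * (E l - E m))) * Real.exp (-(β * E m)) := by
    rw [← Real.exp_add]
    ring_nf
  rw [classicalGenerator_of_ne β σ E h, classicalGenerator_of_ne β σ E h.symm, gibbs, gibbs,
    alpha_eq_exp_mul_alpha_neg hσ (E l - E m), neg_sub, hexp]
  ring

theorem dephasingRate_pos (hβ : 0 ≤ β) (hσ : 0 < σ) (E : Fin n → ℝ) (l m : Fin n) :
    0 < dephasingRate β σ E l m := by
  have hn : (0 : ℝ) < n := Nat.cast_pos.mpr l.pos
  refine mul_pos (by positivity) (Finset.sum_pos (fun j _ => ?_) ⟨l, Finset.mem_univ l⟩)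
  exact add_pos (alpha_pos hβ hσ _) (alpha_pos hβ hσ _)

end Rates

section Decomposition

theorem matrixElement_ketbra_mul (x y z w : EuclideanSpace ℂ (Fin n)) (A : Mat n) :
    matrixElement x y (ketbra z w * A) = inner ℂ x z * matrixElement w y A := by
  simp only [matrixElement_apply, ketbra, Matrix.vecMulVec_mul, Matrix.vecMulVec_mulVec,
    EuclideanSpace.inner_eq_star_dotProduct, dotProduct_smul, op_smul_eq_smul, smul_eq_mul,
    Matrix.dotProduct_mulVec]
  rw [mul_comm, dotProduct_comm (star x.ofLp)]

theorem matrixElement_mul_ketbra (x y z w : EuclideanSpace ℂ (Fin n)) (A : Mat n) :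
    matrixElement x y (A * ketbra z w) = matrixElement x z A * inner ℂ w y := by
  simp only [matrixElement_apply, ketbra, Matrix.mul_vecMulVec, Matrix.vecMulVec_mulVec,
    EuclideanSpace.inner_eq_star_dotProduct, dotProduct_smul, op_smul_eq_smul, smul_eq_mul]
  rw [mul_comm, dotProduct_comm (star w.ofLp)]

theorem sandwich_ketbra_apply (a x y b : EuclideanSpace ℂ (Fin n)) (N : Mat n) :
    sandwich (ketbra a x) (ketbra y b) N = matrixElement x y N • ketbra a b := by
  rw [sandwich_apply, ketbra_mul_mul_ketbra]

variable (v : OrthonormalBasis (Fin n) ℂ (EuclideanSpace ℂ (Fin n)))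

theorem matrixElement_basis_ketbra (l m a b : Fin n) :
    matrixElement (v l) (v m) (ketbra (v a) (v b)) = if l = a ∧ b = m then 1 else 0 := by
  rw [matrixElement_ketbra, v.inner_eq_ite, v.inner_eq_ite, ite_and]
  split_ifs <;> simp

theorem matrixElement_dissipator_ketbra (a b l m : Fin n) (N : Mat n) :
    matrixElement (v l) (v m) (dissipator (ketbra (v a) (v b)) (ketbra (v b) (v a)) N)
      = (if l = a ∧ a = m then matrixElement (v b) (v b) N else 0)
        - 1 / 2 * ((if l = b then 1 else 0) + if b = m then 1 else 0)
          * matrixElement (v l) (v m) N := by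
  rw [dissipator_apply, ketbra_mul_mul_ketbra, ketbra_mul_ketbra, v.inner_eq_one, one_smul]
  simp only [map_sub, map_add, map_smul, smul_eq_mul, matrixElement_basis_ketbra,
    matrixElement_ketbra_mul, matrixElement_mul_ketbra, v.inner_eq_ite, mul_ite, ite_mul, one_mul,
    mul_one, mul_zero, zero_mul]
  rw [mul_assoc, add_mul, ite_mul, ite_mul, one_mul, zero_mul]
  congr 3
  · split_ifs with h <;> simp [h]
  · split_ifs with h <;> simp [h]

theorem matrixElement_classicalPart (β σ : ℝ) (E : Fin n → ℝ) (l m : Fin n) (N : Mat n) :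
    matrixElement (v l) (v m) (classicalPart β σ E v N)
      = if l = m then ∑ k, (classicalGenerator β σ E l k : ℂ) * matrixElement (v k) (v k) N
        else 0 := by
  simp only [classicalPart, _root_.sum_apply, _root_.smul_apply, sandwich_ketbra_apply, map_sum,
    map_smul, matrixElement_basis_ketbra, smul_eq_mul]
  rw [Finset.sum_eq_single l (fun a _ ha => by simp [ha.symm]) (by simp)]
  simp

theorem matrixElement_dephasingPart (β σ : ℝ) (E : Fin n → ℝ) (l m : Fin n) (N : Mat n) :
    matrixElement (v l) (v m) (dephasingPart β σ E v N)
      = if l = m then 0 else -(dephasingRate β σ E l m : ℂ) * matrixElement (v l) (v m) N := by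
  simp only [dephasingPart, _root_.neg_apply, _root_.sum_apply, _root_.smul_apply,
    sandwich_ketbra_apply, map_neg, map_sum, map_smul, matrixElement_basis_ketbra, smul_eq_mul]
  rw [Finset.sum_eq_single l (fun a _ ha => by simp [ha.symm]) (by simp)]
  by_cases h : l = m
  · simp [h]
  · rw [Finset.sum_eq_single_of_mem m (by simp [Ne.symm h]) (fun b _ hb => by simp [hb])]
    simp [h]

variable {v} {H : Mat n} {E : Fin n → ℝ}
  (hv : ∀ j, Matrix.toEuclideanLin H (v j) = (E j : ℂ) • v j) (hH : H.IsHermitian) {β σ : ℝ}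
  {D : Measure (U n)} [IsProbabilityMeasure D]

include hv in
theorem matrixElement_averageLindbladian (hD : IsUnitaryOneDesign D) (hβ : 0 ≤ β) (hσ : 0 < σ)
    (l m : Fin n) (N : Mat n) :
    matrixElement (v l) (v m) (averageLindbladian hH β σ D N)
      = (if l = m then ∑ k, (alpha β σ (E l - E k) / n : ℂ) * matrixElement (v k) (v k) N else 0)
        - dephasingRate β σ E l m * matrixElement (v l) (v m) N := by
  have hgain : ∑ a, ∑ b, (alpha β σ (E a - E b) : ℂ)
      * (if l = a ∧ a = m then matrixElement (v b) (v b) N else 0)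
      = if l = m then ∑ k, (alpha β σ (E l - E k) : ℂ) * matrixElement (v k) (v k) N else 0 := by
    rw [Finset.sum_eq_single l (fun a _ ha => by simp [ha.symm]) (by simp)]
    simp [Finset.sum_ite_irrel]
  have hloss : ∑ a, ∑ b, (alpha β σ (E a - E b) : ℂ)
      * ((if l = b then 1 else 0) + if b = m then 1 else 0)
      = ∑ j, (alpha β σ (E j - E l) + alpha β σ (E j - E m) : ℂ) := by
    simp [mul_add, Finset.sum_add_distrib]
  rw [averageLindbladian_eq_sum hv hH hD hβ hσ]
  simp only [_root_.smul_apply, _root_.sum_apply, map_smul, map_sum, smul_eq_mul,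
    matrixElement_dissipator_ketbra, Fintype.sum_prod_type]
  calc _ = 1 / (n : ℂ) * (∑ a, ∑ b, (alpha β σ (E a - E b) : ℂ)
        * (if l = a ∧ a = m then matrixElement (v b) (v b) N else 0)
      - (∑ a, ∑ b, (alpha β σ (E a - E b) : ℂ)
        * ((if l = b then 1 else 0) + if b = m then 1 else 0))
          * (1 / 2 * matrixElement (v l) (v m) N)) := by
        simp only [Finset.sum_mul, ← Finset.sum_sub_distrib]
        exact congrArg _ (Finset.sum_congr rfl fun a _ => Finset.sum_congr rfl fun b _ => by ring)
    _ = _ := by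
        rw [hgain, hloss, dephasingRate, mul_sub, mul_ite, mul_zero, Finset.mul_sum]
        push_cast
        congr! 1
        · congr! 2
          ring
        · ring

include hv in
theorem averageLindbladian_eq (hD : IsUnitaryOneDesign D) (hβ : 0 ≤ β) (hσ : 0 < σ) :
    averageLindbladian hH β σ D = classicalPart β σ E v + dephasingPart β σ E v := by
  ext1 N
  refine ext_matrixElement v fun l m => ?_
  rw [matrixElement_averageLindbladian hv hH hD hβ hσ, _root_.add_apply, map_add,
    matrixElement_classicalPart, matrixElement_dephasingPart]
  obtain rfl | h := eq_or_ne l m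
  · simp [classicalGenerator_eq, sub_mul, Finset.sum_sub_distrib, apply_ite Complex.ofReal]
  · simp [h]

end Decomposition

section Blocks

variable (v : OrthonormalBasis (Fin n) ℂ (EuclideanSpace ℂ (Fin n)))

theorem matrixElement_sum_smul_ketbra (f : Fin n × Fin n → ℂ) (l m : Fin n) :
    matrixElement (v l) (v m) (∑ p, f p • ketbra (v p.1) (v p.2)) = f (l, m) := by
  simp only [map_sum, map_smul, matrixElement_basis_ketbra, smul_eq_mul]
  rw [Finset.sum_eq_single (l, m) _ (by simp)]
  · simp
  · rintro ⟨a, b⟩ - hab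
    rw [if_neg (by rintro ⟨rfl, rfl⟩; exact hab rfl), mul_zero]

/-- The coordinates of a matrix in the basis `|l⟩⟨m|`, split into the populations `⟨m|N|m⟩` and
the coherences `⟨l|N|m⟩`, `l ≠ m`. -/
noncomputable def blockCoord :
    Mat n ≃ₗ[ℂ] (Fin n → ℂ) × ({p : Fin n × Fin n // p.1 ≠ p.2} → ℂ) where
  toFun N := (fun m => matrixElement (v m) (v m) N,
    fun p => matrixElement (v p.1.1) (v p.1.2) N)
  map_add' M N := by simp only [map_add]; rfl
  map_smul' c N := by simp only [map_smul]; rfl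
  invFun z := ∑ p : Fin n × Fin n,
    (if h : p.1 = p.2 then z.1 p.1 else z.2 ⟨p, h⟩) • ketbra (v p.1) (v p.2)
  left_inv N := by
    refine ext_matrixElement v fun l m => ?_
    rw [matrixElement_sum_smul_ketbra v fun p =>
      if _ : p.1 = p.2 then matrixElement (v p.1) (v p.1) N else matrixElement (v p.1) (v p.2) N]
    split_ifs with h <;> simp_all
  right_inv z := by
    refine Prod.ext (funext fun m => ?_) (funext fun p => ?_)
    · exact (matrixElement_sum_smul_ketbra v _ m m).trans (dif_pos rfl)
    · exact (matrixElement_sum_smul_ketbra v _ p.1.1 p.1.2).trans (dif_neg p.2)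

theorem blockCoord_apply (N : Mat n) :
    blockCoord v N = (fun m => matrixElement (v m) (v m) N,
      fun p => matrixElement (v p.1.1) (v p.1.2) N) := rfl

theorem conj_blockCoord (β σ : ℝ) (E : Fin n → ℝ) :
    (blockCoord v).conj
        ((classicalPart β σ E v + dephasingPart β σ E v : Superop n) : Mat n →ₗ[ℂ] Mat n)
      = (Matrix.toLin' ((classicalGenerator β σ E).map ((↑) : ℝ → ℂ))).prodMap
          (Matrix.toLin' (Matrix.diagonal fun p : {p : Fin n × Fin n // p.1 ≠ p.2} =>
            (-(dephasingRate β σ E p.1.1 p.1.2) : ℂ))) := by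
  refine LinearMap.ext fun z => ?_
  obtain ⟨N, rfl⟩ := (blockCoord v).surjective z
  rw [LinearEquiv.conj_apply_apply, LinearEquiv.symm_apply_apply, blockCoord_apply,
    blockCoord_apply]
  refine Prod.ext (funext fun m => ?_) (funext fun p => ?_)
  · simp [matrixElement_classicalPart, matrixElement_dephasingPart, Matrix.mulVec, dotProduct]
  · simp [matrixElement_classicalPart, matrixElement_dephasingPart, p.2, Matrix.mulVec_diagonal]

theorem zero_mem_roots_charpoly_classicalGenerator (β σ : ℝ) (E : Fin n → ℝ) (hn : 0 < n) :
    0 ∈ (Matrix.toLin' ((classicalGenerator β σ E).map ((↑) : ℝ → ℂ))).charpoly.roots := by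
  have : Nonempty (Fin n) := ⟨⟨0, hn⟩⟩
  rw [Matrix.charpoly_toLin']
  refine zero_mem_roots_charpoly_of_vecMul_eq_zero (one_ne_zero' (Fin n → ℂ)) (funext fun m => ?_)
  simpa [Matrix.vecMul, dotProduct] using
    congrArg ((↑) : ℝ → ℂ) (sum_classicalGenerator β σ E m)

theorem nonempty_offDiag (hn : 2 ≤ n) : Nonempty {p : Fin n × Fin n // p.1 ≠ p.2} :=
  ⟨⟨(⟨0, by omega⟩, ⟨1, by omega⟩), by simp⟩⟩

theorem spectralGap_classicalPart_add_dephasingPart {β σ : ℝ} (hβ : 0 ≤ β) (hσ : 0 < σ)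
    (E : Fin n → ℝ) (hn : 2 ≤ n) :
    spectralGap ((classicalPart β σ E v + dephasingPart β σ E v : Superop n) : Mat n →ₗ[ℂ] Mat n)
      = min (spectralGap (Matrix.toLin' ((classicalGenerator β σ E).map ((↑) : ℝ → ℂ))))
          (⨅ p : {p : Fin n × Fin n // p.1 ≠ p.2}, dephasingRate β σ E p.1.1 p.1.2) := by
  have := nonempty_offDiag hn
  rw [← spectralGap_conj (blockCoord v), conj_blockCoord,
    spectralGap_prodMap_diagonal (by simpa using Nat.lt_of_succ_le hn)
      (zero_mem_roots_charpoly_classicalGenerator β σ E (by omega))]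
  simp_rw [norm_neg, Complex.norm_of_nonneg (dephasingRate_pos hβ hσ E _ _).le]

end Blocks

/-! ### Lower bounds on the gap -/

section LowerBounds

variable {β σ : ℝ}

theorem sum_div_le_spectralGap_classicalGenerator {E u : Fin n → ℝ}
    (hu : ∀ l m, u l ≤ alpha β σ (E l - E m)) (hn : 2 ≤ n) :
    (∑ l, u l) / n
      ≤ spectralGap (Matrix.toLin' ((classicalGenerator β σ E).map ((↑) : ℝ → ℂ))) := by
  refine le_spectralGap (by simpa using Nat.lt_of_succ_le hn) fun z hz => ?_
  rw [Matrix.charpoly_toLin'] at hz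
  rw [Finset.sum_div]
  refine sum_le_norm_of_mem_roots_charpoly_erase (sum_classicalGenerator β σ E) (fun l m h => ?_) hz
  rw [classicalGenerator_of_ne β σ E h]
  exact div_le_div_of_nonneg_right (hu l m) n.cast_nonneg

theorem sum_div_le_dephasingRate {E u : Fin n → ℝ} (hu : ∀ l m, u l ≤ alpha β σ (E l - E m))
    (l m : Fin n) : (∑ j, u j) / n ≤ dephasingRate β σ E l m :=
  calc (∑ j, u j) / n = 1 / (2 * n) * ∑ j, (u j + u j) := by
        rw [Finset.sum_add_distrib]
        ring
    _ ≤ dephasingRate β σ E l m :=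
        mul_le_mul_of_nonneg_left
          (Finset.sum_le_sum fun j _ => add_le_add (hu j l) (hu j m)) (by positivity)

theorem sum_ite_div_eq_mul_lowEnergyFraction {H : Mat n} (hH : H.IsHermitian) (β C c : ℝ) :
    (∑ l, if β * (hH.eigenvalues l - ⨅ k, hH.eigenvalues k) ≤ C then c else 0) / n
      = c * lowEnergyFraction hH β C := by
  rw [lowEnergyFraction, Nat.card_eq_fintype_card, Fintype.card_subtype, ← Finset.sum_filter,
    Finset.sum_const, nsmul_eq_mul]
  ring

theorem mul_lowEnergyFraction_le_spectralGap {D : Measure (U n)} [IsProbabilityMeasure D]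
    (hD : IsUnitaryOneDesign D) {H : Mat n} (hH : H.IsHermitian) {K C : ℝ} (hβ : 0 ≤ β)
    (hσ : 0 < σ) (hK : β * σ ≤ K) (hn : 2 ≤ n) :
    1 / 2 * Real.exp (-max (C + K ^ 2 / 2) 0) * lowEnergyFraction hH β C
      ≤ spectralGap (averageLindbladian hH β σ D : Mat n →ₗ[ℂ] Mat n) := by
  have hα : ∀ l m, (if β * (hH.eigenvalues l - ⨅ k, hH.eigenvalues k) ≤ C then
      1 / 2 * Real.exp (-max (C + K ^ 2 / 2) 0) else 0)
      ≤ alpha β σ (hH.eigenvalues l - hH.eigenvalues m) := fun l m => by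
    split_ifs with hl
    · have hlm : β * (hH.eigenvalues l - hH.eigenvalues m) ≤ C :=
        le_trans (by gcongr; exact ciInf_le (Set.finite_range _).bddBelow m) hl
      have hgam := exp_le_gam hβ hσ.le hK hlm
      linarith [half_gam_le_alpha hβ hσ (hH.eigenvalues l - hH.eigenvalues m)]
    · exact (alpha_pos hβ hσ _).le
  have := nonempty_offDiag hn
  rw [averageLindbladian_eq (toEuclideanLin_eigenvectorBasis hH) hH hD hβ hσ,
    spectralGap_classicalPart_add_dephasingPart _ hβ hσ _ hn,
    ← sum_ite_div_eq_mul_lowEnergyFraction]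
  exact le_min (sum_div_le_spectralGap_classicalGenerator hα hn)
    (le_ciInf fun p => sum_div_le_dephasingRate hα _ _)

theorem lowEnergyFraction_nonneg {H : Mat n} (hH : H.IsHermitian) (β C : ℝ) :
    0 ≤ lowEnergyFraction hH β C := by
  unfold lowEnergyFraction
  positivity

theorem abs_eigenvalues_le_norm {H : Mat n} (hH : H.IsHermitian) (j : Fin n) :
    |hH.eigenvalues j| ≤ ‖H‖ := by
  have h := Matrix.l2_opNorm_mulVec H (hH.eigenvectorBasis j)
  change ‖Matrix.toEuclideanLin H (hH.eigenvectorBasis j)‖ ≤ _ at h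
  rwa [toEuclideanLin_eigenvectorBasis, norm_smul, hH.eigenvectorBasis.norm_eq_one, mul_one,
    mul_one, Complex.norm_real, Real.norm_eq_abs] at h

theorem lowEnergyFraction_eq_one {H : Mat n} (hH : H.IsHermitian) {C : ℝ} (hβ : 0 ≤ β)
    (hn : 0 < n) (hC : β * (2 * ‖H‖) ≤ C) : lowEnergyFraction hH β C = 1 := by
  have : Nonempty (Fin n) := ⟨⟨0, hn⟩⟩
  have hmin : -‖H‖ ≤ ⨅ k, hH.eigenvalues k :=
    le_ciInf fun k => (abs_le.mp (abs_eigenvalues_le_norm hH k)).1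
  have hlow : ∀ j, β * (hH.eigenvalues j - ⨅ k, hH.eigenvalues k) ≤ C := fun j =>
    le_trans (by gcongr; linarith [(abs_le.mp (abs_eigenvalues_le_norm hH j)).2]) hC
  rw [lowEnergyFraction, Nat.card_congr (Equiv.subtypeUnivEquiv hlow), Nat.card_fin,
    div_self (Nat.cast_ne_zero.mpr hn.ne')]

end LowerBounds

section Asymptotics

variable {ι : Type*} {𝓕 : Filter ι} {d : ι → ℕ} (hd : ∀ᶠ i in 𝓕, 2 ≤ d i)
  {H : ∀ i, Mat (d i)} (hH : ∀ i, (H i).IsHermitian)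
  {β σ : ι → ℝ} (hβ : ∀ i, 0 < β i) (hσ : ∀ i, 0 < σ i) (hσβ : σ =O[𝓕] fun i => (β i)⁻¹)
  {D : ∀ i, Measure (U (d i))} (hD : ∀ i, IsProbabilityMeasure (D i))
  (hdesign : ∀ i, IsUnitaryOneDesign (D i))

include hd hβ hσ hσβ hD hdesign

theorem lowEnergyFraction_isBigO_spectralGap (C : ℝ) :
    (fun i => lowEnergyFraction (hH i) (β i) C) =O[𝓕] fun i =>
      spectralGap (averageLindbladian (hH i) (β i) (σ i) (D i) : Mat (d i) →ₗ[ℂ] Mat (d i)) := by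
  obtain ⟨K, hK⟩ := hσβ.bound
  have hc : 0 < 1 / 2 * Real.exp (-max (C + K ^ 2 / 2) 0) := by positivity
  refine IsBigO.of_bound (1 / 2 * Real.exp (-max (C + K ^ 2 / 2) 0))⁻¹ ?_
  filter_upwards [hK, hd] with i hKi hdi
  have hβσ : β i * σ i ≤ K := by
    rwa [Real.norm_of_nonneg (hσ i).le, Real.norm_of_nonneg (inv_pos.mpr (hβ i)).le,
      ← div_eq_mul_inv, le_div_iff₀' (hβ i)] at hKi
  have hgap := mul_lowEnergyFraction_le_spectralGap (hdesign i) (hH i) (C := C) (hβ i).le (hσ i)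
    hβσ hdi
  rw [Real.norm_of_nonneg (lowEnergyFraction_nonneg (hH i) (β i) C)]
  exact ((le_inv_mul_iff₀ hc).mpr hgap).trans (by gcongr; exact Real.le_norm_self _)

theorem one_isBigO_spectralGap (hbdd : (fun i => β i * ‖H i‖) =O[𝓕] fun _ => (1 : ℝ)) :
    (fun _ => (1 : ℝ)) =O[𝓕] fun i =>
      spectralGap (averageLindbladian (hH i) (β i) (σ i) (D i) : Mat (d i) →ₗ[ℂ] Mat (d i)) := by
  obtain ⟨K, hK⟩ := hbdd.bound
  refine IsBigO.congr' (lowEnergyFraction_isBigO_spectralGap hd hH hβ hσ hσβ hD hdesign (2 * K))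
    ?_ .rfl
  filter_upwards [hK, hd] with i hKi hdi
  rw [norm_one, mul_one] at hKi
  have := (Real.le_norm_self _).trans hKi
  exact lowEnergyFraction_eq_one (hH i) (hβ i).le (by omega) (by linarith)

end Asymptotics

end CKG

theorem mainTheorem4_general {ι : Type*} {𝓕 : Filter ι} (d : ι → ℕ) (hd : ∀ᶠ i in 𝓕, 2 ≤ d i)
    (H : ∀ i, CKG.Mat (d i)) (hH : ∀ i, (H i).IsHermitian)
    (β σ : ι → ℝ) (hβ : ∀ i, 0 < β i) (hσ : ∀ i, 0 < σ i) (hσβ : σ =O[𝓕] fun i => (β i)⁻¹)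
    (D : ∀ i, Measure (CKG.U (d i))) (hD : ∀ i, IsProbabilityMeasure (D i))
    (hdesign : ∀ i, CKG.IsUnitaryOneDesign (D i)) :
    (∀ i, Integrable (fun V : CKG.U (d i) => CKG.jumpLindbladian (hH i) (β i) (σ i) V) (D i)) ∧
    (∀ i, ∀ (v : OrthonormalBasis (Fin (d i)) ℂ (EuclideanSpace ℂ (Fin (d i)))) (E : Fin (d i) → ℝ),
      (∀ j, Matrix.toEuclideanLin (H i) (v j) = (E j : ℂ) • v j) →
        CKG.averageLindbladian (hH i) (β i) (σ i) (D i)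
            = CKG.classicalPart (β i) (σ i) E v + CKG.dephasingPart (β i) (σ i) E v ∧
        (∀ l m, l ≠ m → 0 < CKG.classicalGenerator (β i) (σ i) E l m) ∧
        (∀ m, ∑ l, CKG.classicalGenerator (β i) (σ i) E l m = 0) ∧
        (∀ l m, CKG.classicalGenerator (β i) (σ i) E l m * CKG.gibbs (β i) E m
            = CKG.classicalGenerator (β i) (σ i) E m l * CKG.gibbs (β i) E l) ∧
        (∀ l m, l ≠ m → 0 < CKG.dephasingRate (β i) (σ i) E l m) ∧
        (2 ≤ d i →
          CKG.spectralGap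
              (CKG.averageLindbladian (hH i) (β i) (σ i) (D i) : CKG.Mat (d i) →ₗ[ℂ] CKG.Mat (d i))
            = min
                (CKG.spectralGap (Matrix.toLin'
                  ((CKG.classicalGenerator (β i) (σ i) E).map ((↑) : ℝ → ℂ))))
                (⨅ p : {p : Fin (d i) × Fin (d i) // p.1 ≠ p.2},
                  CKG.dephasingRate (β i) (σ i) E p.1.1 p.1.2))) ∧
    (∀ C : ℝ,
      (fun i => CKG.lowEnergyFraction (hH i) (β i) C) =O[𝓕]
        (fun i => CKG.spectralGap
          (CKG.averageLindbladian (hH i) (β i) (σ i) (D i) :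
            CKG.Mat (d i) →ₗ[ℂ] CKG.Mat (d i)))) ∧
    ((fun i => β i * ‖H i‖) =O[𝓕] (fun _ => (1 : ℝ)) →
      (fun _ => (1 : ℝ)) =O[𝓕]
        (fun i => CKG.spectralGap
          (CKG.averageLindbladian (hH i) (β i) (σ i) (D i) :
            CKG.Mat (d i) →ₗ[ℂ] CKG.Mat (d i)))) := by
  refine ⟨fun i => CKG.integrable_jumpLindbladian (hH i) (hβ i).le (hσ i), fun i v E hv => ?_,
    CKG.lowEnergyFraction_isBigO_spectralGap hd hH hβ hσ hσβ hD hdesign,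
    CKG.one_isBigO_spectralGap hd hH hβ hσ hσβ hD hdesign⟩
  have hsplit := CKG.averageLindbladian_eq hv (hH i) (hdesign i) (hβ i).le (hσ i)
  refine ⟨hsplit, fun l m => CKG.classicalGenerator_pos (hβ i).le (hσ i) E,
    CKG.sum_classicalGenerator (β i) (σ i) E, CKG.classicalGenerator_mul_gibbs (β i) (hσ i) E,
    fun l m _ => CKG.dephasingRate_pos (hβ i).le (hσ i) E l m, fun hn => ?_⟩
  rw [hsplit]
  exact CKG.spectralGap_classicalPart_add_dephasingPart v (hβ i).le (hσ i) E hn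

theorem mainTheorem4
    (H : ∀ n : ℕ, CKG.Mat n) (hH : ∀ n, (H n).IsHermitian)
    (β σ : ℕ → ℝ) (hβ : ∀ n, 0 < β n) (hσ : ∀ n, 0 < σ n)
    (hσβ : σ =Θ[atTop] fun n => (β n)⁻¹)
    (D : ∀ n : ℕ, Measure (CKG.U n)) (hD : ∀ n, IsProbabilityMeasure (D n))
    (hdesign : ∀ n, CKG.IsUnitaryOneDesign (D n)) :
    -- the expectation exists
    (∀ n, Integrable (fun V : CKG.U n => CKG.jumpLindbladian (hH n) (β n) (σ n) V) (D n)) ∧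
    -- in every energy eigenbasis it splits into a classical and a dephasing part
    (∀ n, ∀ (v : OrthonormalBasis (Fin n) ℂ (EuclideanSpace ℂ (Fin n))) (E : Fin n → ℝ),
      (∀ j, Matrix.toEuclideanLin (H n) (v j) = (E j : ℂ) • v j) →
        CKG.averageLindbladian (hH n) (β n) (σ n) (D n)
            = CKG.classicalPart (β n) (σ n) E v + CKG.dephasingPart (β n) (σ n) E v ∧
        -- the classical part is a Markov generator, reversible for the Gibbs distribution
        (∀ l m, l ≠ m → 0 < CKG.classicalGenerator (β n) (σ n) E l m) ∧
        (∀ m, ∑ l, CKG.classicalGenerator (β n) (σ n) E l m = 0) ∧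
        (∀ l m, CKG.classicalGenerator (β n) (σ n) E l m * CKG.gibbs (β n) E m
            = CKG.classicalGenerator (β n) (σ n) E m l * CKG.gibbs (β n) E l) ∧
        -- every coherence is damped
        (∀ l m, l ≠ m → 0 < CKG.dephasingRate (β n) (σ n) E l m) ∧
        -- the gap is the smaller of the two gaps
        (2 ≤ n →
          CKG.spectralGap
              (CKG.averageLindbladian (hH n) (β n) (σ n) (D n) : CKG.Mat n →ₗ[ℂ] CKG.Mat n)
            = min
                (CKG.spectralGap (Matrix.toLin'
                  ((CKG.classicalGenerator (β n) (σ n) E).map ((↑) : ℝ → ℂ))))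
                (⨅ p : {p : Fin n × Fin n // p.1 ≠ p.2},
                  CKG.dephasingRate (β n) (σ n) E p.1.1 p.1.2))) ∧
    -- the gap is `Ω(δ(n))`
    (∀ C : ℝ,
      (fun n => CKG.lowEnergyFraction (hH n) (β n) C) =O[atTop]
        (fun n => CKG.spectralGap
          (CKG.averageLindbladian (hH n) (β n) (σ n) (D n) : CKG.Mat n →ₗ[ℂ] CKG.Mat n))) ∧
    -- the gap is `Ω(1)` for bounded degree systems
    ((fun n => β n * ‖H n‖) =O[atTop] (fun _ => (1 : ℝ)) →
      (fun _ => (1 : ℝ)) =O[atTop]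
        (fun n => CKG.spectralGap
          (CKG.averageLindbladian (hH n) (β n) (σ n) (D n) : CKG.Mat n →ₗ[ℂ] CKG.Mat n))) :=
  mainTheorem4_general (fun n => n) (eventually_ge_atTop 2) H hH β σ hβ hσ hσβ.1 D hD hdesign
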